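/- All graphs are finite and simple. A \emph{path odd-cover} of a graph $G=(V,E)$ is a collection of paths in the complete graph on $V$ such that every edge of $G$ lies in an odd number, and every non-edge of $G$ in an even number, of the paths; $p_2(G)$ is the minimum cardinality of a path odd-cover of $G$, and $p_{2,\mathrm{iso}}(G)$ is the minimum of $p_2(H)$ over all graphs $H$ that can be obtained from $G$ by adding finitely many (possibly zero) isolated vertices. The linear arboricity $\mathrm{la}(G)$ is the minimum number of pairwise edge-disjoint linear forests (forests of maximum degree at most $2$, i.e. vertex-disjoint unions of paths) into which $E(G)$ decomposes, and for an integer $d\ge 0$, $\mathrm{la}(d)$ denotes the maximum of $\mathrm{la}(H)$ over all graphs $H$ of maximum degree $d$. Let $\Delta(G)$ be the maximum degree of $G$ (with $\Delta(G)=0$ if $G$ has no vertices) and $v_{\mathrm{odd}}(G)$ its number of odd-degree vertices. \textbf{Theorem.} Let $G$ be any graph, let \[ t=\begin{cases} 2 & \text{if } v_{\mathrm{odd}}(G)=4 \text{ and } \Delta(G)\ge 3,\\ \left\lceil v_{\mathrm{odd}}(G)/4\right\rceil & \text{otherwise,}\end{cases} \] and let $d=2\lceil \Delta(G)/2\rceil-2t$.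 Then \[ p_{2,\mathrm{iso}}(G)\le \begin{cases} 2t+\mathrm{la}(d) & \text{if } d\ge 0,\\ v_{\mathrm{odd}}(G)/2 & \text{if } d<0.\end{cases} \] -/

import Mathlib

namespace PathOddCover

/-- A path in the complete graph on the vertex set `V`, together with its two ends. -/
abbrev KPath (V : Type*) : Type _ :=
  (u : V) × (v : V) × (⊤ : SimpleGraph V).Path u v

/-- The edges of a path of the complete graph. -/
def KPath.edges {V : Type*} (p : KPath V) : List (Sym2 V) :=
  p.2.2.1.edges

/-- A family of `k` paths in the complete graph on `V` is a path odd-cover of `G` if the symmetric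
difference of the edge sets is `E(G)`: exactly the edges of `G` lie in an odd number of the
paths. -/
def IsPathOddCover {V : Type*} (G : SimpleGraph V) {k : ℕ} (P : Fin k → KPath V) : Prop :=
  ∀ e : Sym2 V, e ∈ G.edgeSet ↔ Odd {i : Fin k | e ∈ (P i).edges}.ncard

/-- The path odd-cover number `p₂(G)`. -/
noncomputable def pathOddCoverNumber {V : Type*} (G : SimpleGraph V) : ℕ :=
  sInf {k : ℕ | ∃ P : Fin k → KPath V, IsPathOddCover G P}

/-- `p_{2,iso}(G)`: the minimum of `p₂(H)` over all graphs `H` obtained from `G` by adding a finite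
number `m` of isolated vertices. -/
noncomputable def pathOddCoverNumberIso {V : Type*} (G : SimpleGraph V) : ℕ :=
  sInf {k : ℕ | ∃ m : ℕ, pathOddCoverNumber (G ⊕g (⊥ : SimpleGraph (Fin m))) = k}

/-- The number of vertices of odd degree. -/
def oddDegreeCount {V : Type*} [Fintype V] (G : SimpleGraph V) [DecidableRel G.Adj] : ℕ :=
  (Finset.univ.filter fun v : V => Odd (G.degree v)).card

/-- A linear forest: a forest of maximum degree at most two, that is (for finite graphs) a
vertex-disjoint union of paths. -/
def IsLinearForest {V : Type*} (F : SimpleGraph V) : Prop :=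
  F.IsAcyclic ∧ ∀ v : V, (F.neighborSet v).encard ≤ 2

/-- A decomposition of `E(G)` into `k` pairwise edge-disjoint linear forests. -/
def IsLinearForestDecomposition {V : Type*} (G : SimpleGraph V) {k : ℕ}
    (F : Fin k → SimpleGraph V) : Prop :=
  (∀ i, IsLinearForest (F i)) ∧
    (∀ i j, i ≠ j → Disjoint (F i).edgeSet (F j).edgeSet) ∧
    (⋃ i, (F i).edgeSet) = G.edgeSet

/-- The linear arboricity `la(G)`. -/
noncomputable def linearArboricity {V : Type*} (G : SimpleGraph V) : ℕ :=
  sInf {k : ℕ | ∃ F : Fin k → SimpleGraph V, IsLinearForestDecomposition G F}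

/-- The values of `la(H)` over all finite graphs `H` of maximum degree exactly `d`. -/
def linearArboricityValues (d : ℕ) : Set ℕ :=
  {k : ℕ | ∃ (n : ℕ) (H : SimpleGraph (Fin n)) (_ : DecidableRel H.Adj),
    H.maxDegree = d ∧ linearArboricity H = k}

/-- `la(d)`: the maximum of `la(H)` over all finite graphs `H` of maximum degree `d`. -/
noncomputable def maxLinearArboricity (d : ℕ) : ℕ :=
  sSup (linearArboricityValues d)

/-! ### The minima and the maximum above are attained -/

/-- Every finite graph has a path odd-cover: take its edges as paths. -/
theorem exists_isPathOddCover {V : Type*} [Finite V] (G : SimpleGraph V) :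
    ∃ (k : ℕ) (P : Fin k → KPath V), IsPathOddCover G P := by
  classical
  obtain ⟨k, ⟨φ⟩⟩ := Finite.exists_equiv_fin G.edgeSet
  have h : ∀ e : G.edgeSet, ∃ p : KPath V, p.edges = [e.1] := by
    rintro ⟨e, he⟩
    induction e with
    | _ u v =>
      have huv : (⊤ : SimpleGraph V).Adj u v := by simpa using G.ne_of_adj he
      exact ⟨⟨u, v, SimpleGraph.Path.singleton huv⟩, by
        simp [KPath.edges, SimpleGraph.Path.singleton]⟩
  choose p hp using h
  refine ⟨k, fun i => p (φ.symm i), fun e => ?_⟩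
  simp only [hp, List.mem_singleton]
  by_cases he : e ∈ G.edgeSet
  · have : {i : Fin k | e = (φ.symm i).1} = {φ ⟨e, he⟩} := by
      ext i
      simp only [Set.mem_ofPred_eq, Set.mem_singleton_iff]
      constructor
      · rintro rfl; simp
      · rintro rfl; simp
    simp [this, he]
  · have : {i : Fin k | e = (φ.symm i).1} = ∅ := by
      ext i
      simp only [Set.mem_ofPred_eq, Set.mem_empty_iff_false, iff_false]
      rintro rfl
      exact he (φ.symm i).2
    simp [this, he]

/-- `p₂(G)` is attained. -/
theorem pathOddCoverNumber_spec {V : Type*} [Finite V] (G : SimpleGraph V) :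
    ∃ P : Fin (pathOddCoverNumber G) → KPath V, IsPathOddCover G P :=
  Nat.sInf_mem (s := {k : ℕ | ∃ P : Fin k → KPath V, IsPathOddCover G P})
    (exists_isPathOddCover G)

/-- `p_{2,iso}(G)` is attained. -/
theorem pathOddCoverNumberIso_spec {V : Type*} (G : SimpleGraph V) :
    ∃ m : ℕ, pathOddCoverNumber (G ⊕g (⊥ : SimpleGraph (Fin m))) = pathOddCoverNumberIso G :=
  Nat.sInf_mem (s := {k : ℕ | ∃ m : ℕ,
    pathOddCoverNumber (G ⊕g (⊥ : SimpleGraph (Fin m))) = k}) ⟨_, 0, rfl⟩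

/-- A graph of maximum degree at most one is a linear forest. -/
theorem isLinearForest_of_subsingleton {V : Type*} (F : SimpleGraph V)
    (h : ∀ v, (F.neighborSet v).Subsingleton) : IsLinearForest F := by
  refine ⟨fun v c hc => ?_, fun v => ?_⟩
  · exact hc.snd_ne_penultimate (h v (c.adj_snd hc.not_nil)
      (c.adj_penultimate hc.not_nil).symm)
  · exact (Set.encard_le_one_iff_subsingleton.mpr (h v)).trans (by norm_num)

/-- Greedy edge colouring. -/
theorem exists_edgeColoring {V : Type*} [Finite V] (G : SimpleGraph V) (d : ℕ)
    (hd : ∀ v, (G.incidenceSet v).ncard ≤ d) :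
    ∃ c : Sym2 V → Fin (2 * d + 1), ∀ e ∈ G.edgeSet, ∀ f ∈ G.edgeSet,
      e ≠ f → (∃ v, v ∈ e ∧ v ∈ f) → c e ≠ c f := by
  classical
  have key : ∀ S : Set (Sym2 V), S.Finite → S ⊆ G.edgeSet →
      ∃ c : Sym2 V → Fin (2 * d + 1), ∀ e ∈ S, ∀ f ∈ S,
        e ≠ f → (∃ v, v ∈ e ∧ v ∈ f) → c e ≠ c f := by
    intro S hS
    induction S, hS using Set.Finite.induction_on with
    | empty => intro _; exact ⟨fun _ => 0, by simp⟩
    | @insert a S ha _ ih =>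
      intro hsub
      obtain ⟨c, hc⟩ := ih ((Set.subset_insert a S).trans hsub)
      obtain ⟨x, hx⟩ : ∃ x : Fin (2 * d + 1),
          ∀ f ∈ S, (∃ v, v ∈ a ∧ v ∈ f) → c f ≠ x := by
        by_contra! hcon
        induction a with
        | _ u w =>
          have hcov : (Set.univ : Set (Fin (2 * d + 1))) ⊆
              c '' (G.incidenceSet u ∪ G.incidenceSet w) := by
            intro x _
            obtain ⟨f, hf, ⟨v, hva, hvf⟩, hcx⟩ := hcon x
            refine ⟨f, ?_, hcx⟩
            have hfG := hsub (Set.mem_insert_of_mem _ hf)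
            rcases Sym2.mem_iff.mp hva with rfl | rfl
            · exact Or.inl ⟨hfG, hvf⟩
            · exact Or.inr ⟨hfG, hvf⟩
          have h1 := Set.ncard_le_ncard hcov (Set.toFinite _)
          have h2 := Set.ncard_image_le (f := c)
            (Set.toFinite (G.incidenceSet u ∪ G.incidenceSet w))
          have h3 := Set.ncard_union_le (G.incidenceSet u) (G.incidenceSet w)
          have h4 := hd u
          have h5 := hd w
          have h6 : (Set.univ : Set (Fin (2 * d + 1))).ncard = 2 * d + 1 := by
            rw [Set.ncard_univ, Nat.card_eq_fintype_card, Fintype.card_fin]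
          omega
      refine ⟨Function.update c a x, ?_⟩
      have hne : ∀ f ∈ S, f ≠ a := fun f hf h => ha (h ▸ hf)
      intro e he f hf hef hv
      rcases Set.mem_insert_iff.mp he with rfl | heS
      · rcases Set.mem_insert_iff.mp hf with rfl | hf
        · exact absurd rfl hef
        · rw [Function.update_self, Function.update_of_ne (hne f hf)]
          exact (hx f hf hv).symm
      · rcases Set.mem_insert_iff.mp hf with rfl | hf
        · rw [Function.update_self, Function.update_of_ne (hne e heS)]
          obtain ⟨v, h1, h2⟩ := hv
          exact hx e heS ⟨v, h2, h1⟩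
        · rw [Function.update_of_ne (hne e heS), Function.update_of_ne (hne f hf)]
          exact hc e heS f hf hef hv
  exact key G.edgeSet (Set.toFinite _) subset_rfl

/-- A finite graph of maximum degree at most `d` decomposes into `2 * d + 1` linear forests. -/
theorem exists_linearForestDecomposition {V : Type*} [Finite V] (G : SimpleGraph V) (d : ℕ)
    (hd : ∀ v, (G.incidenceSet v).ncard ≤ d) :
    ∃ F : Fin (2 * d + 1) → SimpleGraph V, IsLinearForestDecomposition G F := by
  obtain ⟨c, hc⟩ := exists_edgeColoring G d hd
  have hE : ∀ i, (SimpleGraph.fromEdgeSet {e | e ∈ G.edgeSet ∧ c e = i}).edgeSet =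
      {e | e ∈ G.edgeSet ∧ c e = i} := by
    intro i
    rw [SimpleGraph.edgeSet_fromEdgeSet]
    ext e
    simp only [Set.mem_sdiff, Set.mem_ofPred_eq, and_iff_left_iff_imp]
    rintro ⟨he, _⟩
    exact G.not_isDiag_of_mem_edgeSet he
  refine ⟨fun i => SimpleGraph.fromEdgeSet {e | e ∈ G.edgeSet ∧ c e = i}, ?_, ?_, ?_⟩
  · intro i
    refine isLinearForest_of_subsingleton _ fun v x hx y hy => ?_
    rw [SimpleGraph.mem_neighborSet, SimpleGraph.fromEdgeSet_adj] at hx hy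
    by_contra hxy
    refine hc s(v, x) hx.1.1 s(v, y) hy.1.1 (fun h => hxy ?_) ⟨v, by simp, by simp⟩
      (hx.1.2.trans hy.1.2.symm)
    exact Sym2.congr_right.mp h
  · intro i j hij
    rw [hE, hE, Set.disjoint_left]
    rintro e ⟨_, h1⟩ ⟨_, h2⟩
    exact hij (h1.symm.trans h2)
  · ext e
    simp only [hE, Set.mem_iUnion, Set.mem_ofPred_eq]
    exact ⟨fun ⟨_, h, _⟩ => h, fun h => ⟨c e, h, rfl⟩⟩

/-- `la(G)` is attained. -/
theorem linearArboricity_spec {V : Type*} [Finite V] (G : SimpleGraph V) :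
    ∃ F : Fin (linearArboricity G) → SimpleGraph V, IsLinearForestDecomposition G F :=
  Nat.sInf_mem (s := {k : ℕ | ∃ F : Fin k → SimpleGraph V, IsLinearForestDecomposition G F})
    ⟨_, exists_linearForestDecomposition G (Nat.card (Sym2 V))
      fun _ => Set.ncard_le_card _⟩

/-- `la(d)` is a maximum: it is attained and bounds every `la(H)` with `Δ(H) = d`. -/
theorem maxLinearArboricity_isGreatest (d : ℕ) :
    IsGreatest (linearArboricityValues d) (maxLinearArboricity d) := by
  classical
  have hb : BddAbove (linearArboricityValues d) := by
    refine ⟨2 * d + 1, ?_⟩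
    rintro k ⟨n, H, _, hH, rfl⟩
    refine Nat.sInf_le (exists_linearForestDecomposition H d fun v => ?_)
    rw [← Nat.card_coe_set_eq, Nat.card_eq_fintype_card, SimpleGraph.card_incidenceSet_eq_degree]
    exact hH ▸ H.degree_le_maxDegree v
  have hne : (linearArboricityValues d).Nonempty := by
    refine ⟨_, d + 1, (⊤ : SimpleGraph (Fin (d + 1))), inferInstance, ?_, rfl⟩
    refine le_antisymm (SimpleGraph.maxDegree_le_of_forall_degree_le _ _ fun v => ?_) ?_
    · simp
    · exact le_trans (by simp) (SimpleGraph.degree_le_maxDegree _ (0 : Fin (d + 1)))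
  exact ⟨Nat.sSup_mem hne hb, fun k hk => le_csSup hb hk⟩

end PathOddCover

/-! Chains of edges modulo 2 are taken on the vertex set `V ⊕ ℕ`, so that new isolated vertices
never run out. Paths form an odd-cover when their chains sum to the chain of `G`, and the boundary
of a chain records the vertices of odd degree.

Let `Δ(G) ≤ 2(r + t)`. A Petersen-type argument peels off `t` graphs made of cycles and paths,
leaving a remainder of maximum degree at most `2r` (`exists_splittable`). Each peeled graph splits
into two linear forests, and the remainder into at most `la(2r)`; each forest is a colour. Every
peeled graph also takes care of four or two odd vertices of `G`: with four, each of its two forests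
receives a dummy edge joining two of them; with two, each receives a dummy edge from one of them to
a common new vertex (`exists_colour_family`). The colours now sum to `G` plus the dummy edges, a
chain with zero boundary, so every vertex is an end of an even number of paths.

This evenness allows two paths of one colour to be joined through a new vertex `z`, by edges `az`
and `bz` at their ends `a` and `b`: the same two edges are added again in other colours where `a`
and `b` are ends, and the sum does not change. Repetition turns every colour into at most one path
(`exists_merged`).

A dummy edge `xy` is then removed by closing its path from `p` to `q` through new vertices and
deleting `xy`, which leaves a path from `x` to `y` (`exists_closing`). The edges of the connection
from `q` to `p` are added to the other colours too, which are merged again (`exists_paths`). The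
only obstruction is a colour without dummy edge that has both ends `p` and `q` while no second
colour without dummy edge is available. So it suffices that the number of colours without dummy edge
is not one. For the remainder this can be arranged: a disjoint complete graph on `2r + 1` vertices
is added to it, which contains a triangle if `r > 0`, while for `r = 0` no forest is needed.

If `d < 0`, the peeled graphs exhaust `G` and all colours carry dummy edges; two odd vertices left
over receive one further colour consisting of a dummy edge alone. This gives `v_odd(G) / 2` paths.
-/

namespace PathOddCover

/-! ### Chains modulo 2 and systems of disjoint paths. -/

section Chains

variable {W : Type*}

/-- The boundary of a chain of edges modulo two: its vertices of odd degree. -/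
noncomputable def bdry : (Sym2 W →₀ ZMod 2) →ₗ[ZMod 2] (W →₀ ZMod 2) :=
  Finsupp.linearCombination (ZMod 2)
    (Sym2.lift ⟨fun u v => Finsupp.single u 1 + Finsupp.single v 1, fun _ _ => add_comm _ _⟩)

/-- The chain of a single edge. -/
noncomputable def edgeChain (u v : W) : Sym2 W →₀ ZMod 2 := Finsupp.single s(u, v) 1

theorem edgeChain_comm (u v : W) : edgeChain u v = edgeChain v u := by
  rw [edgeChain, Sym2.eq_swap, edgeChain]

@[simp] theorem bdry_edgeChain (u v : W) :
    bdry (edgeChain u v) = Finsupp.single u 1 + Finsupp.single v 1 := by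
  simp [bdry, edgeChain]

/-- The edges between consecutive members of a list of vertices. -/
def listEdges : List W → List (Sym2 W)
  | a :: b :: l => s(a, b) :: listEdges (b :: l)
  | _ => []

/-- The chain of the edges between consecutive members of a list of vertices. -/
noncomputable def listChain : List W → (Sym2 W →₀ ZMod 2)
  | a :: b :: l => edgeChain a b + listChain (b :: l)
  | _ => 0

@[simp] theorem listEdges_nil : listEdges ([] : List W) = [] := rfl
@[simp] theorem listEdges_singleton (a : W) : listEdges [a] = [] := rfl
@[simp] theorem listEdges_cons_cons (a b : W) (l : List W) :
    listEdges (a :: b :: l) = s(a, b) :: listEdges (b :: l) := rfl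
@[simp] theorem listChain_nil : listChain ([] : List W) = 0 := rfl
@[simp] theorem listChain_singleton (a : W) : listChain [a] = 0 := rfl
@[simp] theorem listChain_cons_cons (a b : W) (l : List W) :
    listChain (a :: b :: l) = edgeChain a b + listChain (b :: l) := rfl

theorem listEdges_append_cons (A : List W) (a : W) (B : List W) :
    listEdges (A ++ a :: B) = listEdges (A ++ [a]) ++ listEdges (a :: B) := by
  induction A with
  | nil => simp
  | cons c A ih => cases A with
    | nil => simp
    | cons d A => simpa using ih

theorem listChain_eq_sum (l : List W) :
    listChain l = ((listEdges l).map fun e => Finsupp.single e 1).sum := by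
  induction l with
  | nil => simp
  | cons a l ih => cases l with
    | nil => simp
    | cons b l => simp [ih, edgeChain]

theorem listChain_append_cons (A : List W) (a : W) (B : List W) :
    listChain (A ++ a :: B) = listChain (A ++ [a]) + listChain (a :: B) := by
  simp [listChain_eq_sum, listEdges_append_cons A a B]

theorem listChain_concat (A : List W) (a b : W) :
    listChain (A ++ [a, b]) = listChain (A ++ [a]) + edgeChain a b := by
  rw [listChain_append_cons]; simp

theorem listEdges_reverse (l : List W) : (listEdges l.reverse).Perm (listEdges l) := by
  induction l with
  | nil => simp
  | cons a l ih => cases l with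
    | nil => simp
    | cons b l =>
      rw [List.reverse_cons, List.reverse_cons, List.append_assoc, List.singleton_append,
        listEdges_append_cons, ← List.reverse_cons, listEdges_cons_cons, Sym2.eq_swap]
      simp only [listEdges_cons_cons, listEdges_singleton]
      rw [Sym2.eq_swap]
      exact (List.perm_append_comm).trans (by simpa [Sym2.eq_swap] using ih)

theorem listChain_reverse (l : List W) : listChain l.reverse = listChain l := by
  rw [listChain_eq_sum, listChain_eq_sum]
  exact ((listEdges_reverse l).map _).sum_eq

theorem mem_of_mem_listEdges {l : List W} {e : Sym2 W} (he : e ∈ listEdges l) {v : W}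
    (hv : v ∈ e) : v ∈ l := by
  induction l with
  | nil => simp at he
  | cons a l ih => cases l with
    | nil => simp at he
    | cons b l =>
      rw [listEdges_cons_cons, List.mem_cons] at he
      rcases he with rfl | he
      · rcases Sym2.mem_iff.mp hv with rfl | rfl <;> simp
      · exact List.mem_cons_of_mem _ (ih he)

theorem nodup_listEdges {l : List W} (hl : l.Nodup) : (listEdges l).Nodup := by
  induction l with
  | nil => simp
  | cons a l ih => cases l with
    | nil => simp
    | cons b l =>
      rw [listEdges_cons_cons, List.nodup_cons]
      refine ⟨fun h => ?_, ih hl.of_cons⟩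
      exact (List.nodup_cons.mp hl).1 (mem_of_mem_listEdges h (Sym2.mem_mk_left a b))

theorem sum_map_single_apply {α : Type*} [DecidableEq α] {L : List α} (hL : L.Nodup) (e : α) :
    (L.map fun e => Finsupp.single e (1 : ZMod 2)).sum e = if e ∈ L then 1 else 0 := by
  induction L with
  | nil => simp
  | cons f L ih =>
    rw [List.map_cons, List.sum_cons, Finsupp.add_apply, ih hL.of_cons, Finsupp.single_apply]
    rcases eq_or_ne f e with rfl | h
    · simp [(List.nodup_cons.mp hL).1]
    · simp [h, h.symm]

theorem listChain_apply [DecidableEq W] {l : List W} (hl : l.Nodup) (e : Sym2 W) :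
    listChain l e = if e ∈ listEdges l then 1 else 0 := by
  rw [listChain_eq_sum, sum_map_single_apply (nodup_listEdges hl)]

theorem exists_append_of_mem_listEdges {l : List W} {x y : W} (h : s(x, y) ∈ listEdges l) :
    ∃ A B, l = A ++ x :: y :: B ∨ l = A ++ y :: x :: B := by
  induction l with
  | nil => simp at h
  | cons a l ih => cases l with
    | nil => simp at h
    | cons b l =>
      rw [listEdges_cons_cons, List.mem_cons] at h
      rcases h with h | h
      · rcases Sym2.eq_iff.mp h with ⟨rfl, rfl⟩ | ⟨rfl, rfl⟩
        · exact ⟨[], l, Or.inl rfl⟩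
        · exact ⟨[], l, Or.inr rfl⟩
      · obtain ⟨A, B, h | h⟩ := ih h
        · exact ⟨a :: A, B, Or.inl (by rw [h]; rfl)⟩
        · exact ⟨a :: A, B, Or.inr (by rw [h]; rfl)⟩

/-- Inner vertices are counted twice. Since a path with an edge has two distinct ends, "`v` is an
end of the system `T`" can be expressed as `bdry (sysChain T) v ≠ 0`, which is done throughout. -/
theorem bdry_listChain_cons_concat (p : W) (M : List W) (q : W) :
    bdry (listChain (p :: (M ++ [q]))) = Finsupp.single p 1 + Finsupp.single q 1 := by
  induction M generalizing p with
  | nil => simp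
  | cons b M ih =>
    rw [List.cons_append, listChain_cons_cons, map_add, ih, bdry_edgeChain, add_assoc,
      ← add_assoc (Finsupp.single b (1 : ZMod 2)), ZModModule.add_self, zero_add]

theorem exists_eq_cons_concat {A : List W} (h : 2 ≤ A.length) :
    ∃ p M q, A = p :: (M ++ [q]) := by
  cases A with
  | nil => simp at h
  | cons p A =>
    have hA : A ≠ [] := by rintro rfl; simp at h
    exact ⟨p, A.dropLast, A.getLast hA, by rw [List.dropLast_append_getLast]⟩

theorem bdry_listChain_eq_zero_of_notMem {A : List W} {v : W} (h : v ∉ A) :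
    bdry (listChain A) v = 0 := by
  rcases lt_or_ge A.length 2 with hA | hA
  · rcases A with _ | ⟨a, _ | ⟨b, A⟩⟩
    · simp
    · simp
    · simp at hA
  · obtain ⟨p, M, q, rfl⟩ := exists_eq_cons_concat hA
    rw [bdry_listChain_cons_concat]
    simp only [List.mem_cons, List.mem_append, not_or, List.not_mem_nil, not_false_eq_true,
      and_true] at h
    simp [Ne.symm h.1, Ne.symm h.2.2]

/-- A path with end `v` can be traversed so that `v` comes last. -/
theorem exists_perm_concat {A : List W} (h : 2 ≤ A.length) {v : W}
    (hv : bdry (listChain A) v ≠ 0) :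
    ∃ p M, (p :: (M ++ [v])).Perm A ∧ listChain (p :: (M ++ [v])) = listChain A ∧
      (listEdges (p :: (M ++ [v]))).Perm (listEdges A) := by
  classical
  obtain ⟨p, M, q, rfl⟩ := exists_eq_cons_concat h
  rw [bdry_listChain_cons_concat, Finsupp.add_apply, Finsupp.single_apply,
    Finsupp.single_apply] at hv
  by_cases hq : q = v
  · subst hq
    exact ⟨p, M, List.Perm.refl _, rfl, List.Perm.refl _⟩
  · have hp : p = v := by
      by_contra hp
      simp [hp, hq] at hv
    subst hp
    have e : q :: (M.reverse ++ [p]) = (p :: (M ++ [q])).reverse := by simp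
    refine ⟨q, M.reverse, ?_, ?_, ?_⟩
    · rw [e]; exact List.reverse_perm _
    · rw [e, listChain_reverse]
    · rw [e]; exact listEdges_reverse _

/-- The chain of a system of paths. -/
noncomputable def sysChain (T : List (List W)) : Sym2 W →₀ ZMod 2 := (T.map listChain).sum

@[simp] theorem sysChain_nil : sysChain ([] : List (List W)) = 0 := rfl
@[simp] theorem sysChain_cons (A : List W) (T : List (List W)) :
    sysChain (A :: T) = listChain A + sysChain T := by simp [sysChain]

/-- A system of pairwise disjoint paths, each with at least one edge. -/
structure IsPathSystem (T : List (List W)) : Prop where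
  nodup : T.flatten.Nodup
  two_le : ∀ A ∈ T, 2 ≤ A.length

/-- The edges of a system of paths. -/
def sysEdges (T : List (List W)) : List (Sym2 W) := T.flatMap listEdges

@[simp] theorem sysEdges_nil : sysEdges ([] : List (List W)) = [] := rfl
@[simp] theorem sysEdges_cons (A : List W) (T : List (List W)) :
    sysEdges (A :: T) = listEdges A ++ sysEdges T := by simp [sysEdges]

theorem bdry_sysChain_eq_zero_of_notMem {T : List (List W)} {v : W} (h : v ∉ T.flatten) :
    bdry (sysChain T) v = 0 := by
  induction T with
  | nil => simp
  | cons A T ih =>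
    rw [List.flatten_cons, List.mem_append, not_or] at h
    rw [sysChain_cons, map_add, Finsupp.add_apply, bdry_listChain_eq_zero_of_notMem h.1, ih h.2,
      add_zero]

theorem IsPathSystem.tail {A : List W} {T : List (List W)} (h : IsPathSystem (A :: T)) :
    IsPathSystem T where
  nodup := (List.nodup_append.mp (by simpa using h.nodup)).2.1
  two_le B hB := h.two_le B (List.mem_cons_of_mem _ hB)

theorem IsPathSystem.head_nodup {A : List W} {T : List (List W)} (h : IsPathSystem (A :: T)) :
    A.Nodup :=
  (List.nodup_append.mp (by simpa using h.nodup)).1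

theorem IsPathSystem.disjoint {A : List W} {T : List (List W)} (h : IsPathSystem (A :: T))
    {v : W} (hv : v ∈ A) : v ∉ T.flatten := fun hT =>
  (List.nodup_append.mp (by simpa using h.nodup)).2.2 v hv v hT rfl

/-- Every end of a path system is the last vertex of the first path after rearrangement. -/
theorem IsPathSystem.exists_concat_cons {T : List (List W)} (hT : IsPathSystem T) {v : W}
    (hv : bdry (sysChain T) v ≠ 0) :
    ∃ p M R, IsPathSystem ((p :: (M ++ [v])) :: R) ∧ R.length + 1 = T.length ∧
      ((p :: (M ++ [v])) ++ R.flatten).Perm T.flatten ∧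
      listChain (p :: (M ++ [v])) + sysChain R = sysChain T ∧
      (listEdges (p :: (M ++ [v])) ++ sysEdges R).Perm (sysEdges T) := by
  induction T with
  | nil => simp at hv
  | cons A T ih =>
    by_cases hA : bdry (listChain A) v = 0
    · rw [sysChain_cons, map_add, Finsupp.add_apply, hA, zero_add] at hv
      obtain ⟨p, M, R, h1, h2, h3, h4, h5⟩ := ih hT.tail hv
      have h3' : ((p :: (M ++ [v])) ++ (A :: R).flatten).Perm (A :: T).flatten := by
        rw [List.flatten_cons, List.flatten_cons]
        refine List.Perm.trans ?_ (List.Perm.append_left A h3)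
        exact List.perm_append_comm_assoc _ _ _
      refine ⟨p, M, A :: R, ⟨?_, ?_⟩, by simp [h2], h3', ?_, ?_⟩
      · rw [List.flatten_cons]
        exact h3'.nodup_iff.mpr hT.nodup
      · intro B hB
        rcases List.mem_cons.mp hB with rfl | hB
        · simp
        · rcases List.mem_cons.mp hB with rfl | hB
          · exact hT.two_le _ (by simp)
          · exact h1.two_le _ (List.mem_cons_of_mem _ hB)
      · rw [sysChain_cons, sysChain_cons, ← h4, add_left_comm]
      · rw [sysEdges_cons, sysEdges_cons]
        exact (List.perm_append_comm_assoc _ _ _).trans (List.Perm.append_left _ h5)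
    · obtain ⟨p, M, h1, h2, h3⟩ := exists_perm_concat (hT.two_le A (by simp)) hA
      have h4 : ((p :: (M ++ [v])) ++ T.flatten).Perm (A :: T).flatten := by
        rw [List.flatten_cons]
        exact List.Perm.append_right _ h1
      refine ⟨p, M, T, ⟨?_, ?_⟩, by simp, h4, by rw [h2, sysChain_cons], ?_⟩
      · rw [List.flatten_cons]
        exact h4.nodup_iff.mpr hT.nodup
      · intro B hB
        rcases List.mem_cons.mp hB with rfl | hB
        · simp
        · exact hT.two_le _ (List.mem_cons_of_mem _ hB)
      · rw [sysEdges_cons]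
        exact List.Perm.append_right _ h3

/-- A path of a system can be extended by a new vertex at one of its ends. -/
theorem IsPathSystem.exists_extend {T : List (List W)} (hT : IsPathSystem T) {v z : W}
    (hv : bdry (sysChain T) v ≠ 0) (hz : z ∉ T.flatten) :
    ∃ T', IsPathSystem T' ∧ sysChain T' = sysChain T + edgeChain v z ∧ T'.length = T.length ∧
      T'.flatten.Perm (z :: T.flatten) ∧ sysEdges T ⊆ sysEdges T' := by
  obtain ⟨p, M, R, h1, h2, h3, h4, h5⟩ := hT.exists_concat_cons hv
  have h6 : ((p :: (M ++ [v, z])) :: R).flatten.Perm (z :: T.flatten) := by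
    refine List.Perm.trans ?_ (List.Perm.cons z h3)
    rw [List.flatten_cons, show p :: (M ++ [v, z]) = (p :: (M ++ [v])) ++ [z] by simp,
      List.append_assoc]
    exact List.perm_middle
  refine ⟨(p :: (M ++ [v, z])) :: R, ⟨?_, ?_⟩, ?_, by simp [h2], h6, ?_⟩
  · rw [h6.nodup_iff, List.nodup_cons]
    exact ⟨hz, hT.nodup⟩
  · intro B hB
    rcases List.mem_cons.mp hB with rfl | hB
    · simp
    · exact h1.two_le _ (List.mem_cons_of_mem _ hB)
  · rw [sysChain_cons, ← h4, ← List.cons_append, listChain_concat, List.cons_append]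
    abel
  · intro e he
    rw [← h5.mem_iff, List.mem_append] at he
    rw [sysEdges_cons, List.mem_append, ← List.cons_append, listEdges_append_cons]
    rcases he with he | he
    · exact Or.inl (List.mem_append_left _ he)
    · exact Or.inr he

/-- Two paths of a system can be joined through a new vertex. -/
theorem IsPathSystem.exists_join {A : List W} {R : List (List W)} (hT : IsPathSystem (A :: R))
    {a b z : W} (ha : bdry (listChain A) a ≠ 0) (hb : bdry (sysChain R) b ≠ 0)
    (hz : z ∉ (A :: R).flatten) :
    ∃ T', IsPathSystem T' ∧
      sysChain T' = sysChain (A :: R) + (edgeChain a z + edgeChain b z) ∧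
      T'.length + 1 = (A :: R).length ∧ sysEdges (A :: R) ⊆ sysEdges T' := by
  obtain ⟨p, M, h1, h2, h3⟩ := exists_perm_concat (hT.two_le A (by simp)) ha
  obtain ⟨q, N, S, g1, g2, g3, g4, g5⟩ := hT.tail.exists_concat_cons hb
  have hr : b :: (N.reverse ++ [q]) = (q :: (N ++ [b])).reverse := by simp
  set P : List W := (p :: (M ++ [a])) ++ z :: (b :: (N.reverse ++ [q])) with hP
  have h6 : (P :: S).flatten.Perm (z :: (A :: R).flatten) := by
    rw [List.flatten_cons, List.flatten_cons, hP, List.append_assoc]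
    refine List.perm_middle.trans (List.Perm.cons z ?_)
    refine List.Perm.append h1 (List.Perm.trans ?_ g3)
    rw [hr]
    exact List.Perm.append_right _ (List.reverse_perm _)
  have hc : listChain P = listChain A + (edgeChain a z + edgeChain b z) +
      listChain (q :: (N ++ [b])) := by
    rw [hP, ← h2, ← listChain_reverse (q :: (N ++ [b])), ← hr, listChain_append_cons,
      List.cons_append, List.append_assoc, List.singleton_append, ← List.cons_append,
      listChain_concat, listChain_cons_cons, edgeChain_comm z b, List.cons_append]
    abel
  refine ⟨P :: S, ⟨?_, ?_⟩, ?_, by simp [g2], ?_⟩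
  · rw [h6.nodup_iff, List.nodup_cons]
    exact ⟨hz, hT.nodup⟩
  · intro B hB
    rcases List.mem_cons.mp hB with rfl | hB
    · simp [hP]; omega
    · exact g1.two_le _ (List.mem_cons_of_mem _ hB)
  · rw [sysChain_cons, sysChain_cons, hc, ← g4]
    abel
  · intro e he
    rw [sysEdges_cons, List.mem_append] at he ⊢
    have hP' : listEdges P = listEdges (p :: (M ++ [a])) ++
        (s(a, z) :: s(z, b) :: listEdges (b :: (N.reverse ++ [q]))) := by
      rw [hP, show (p :: (M ++ [a])) ++ z :: (b :: (N.reverse ++ [q])) =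
        (p :: M) ++ a :: z :: b :: (N.reverse ++ [q]) by simp, listEdges_append_cons]
      simp
    rw [hP']
    rcases he with he | he
    · exact Or.inl (List.mem_append_left _ (h3.mem_iff.mpr he))
    · rw [← g5.mem_iff, List.mem_append] at he
      rcases he with he | he
      · refine Or.inl (List.mem_append_right _ ?_)
        rw [hr]
        exact List.mem_cons_of_mem _ (List.mem_cons_of_mem _
          ((listEdges_reverse _).mem_iff.mpr he))
      · exact Or.inr he

/-- A path with the edge `xy` becomes, after deletion of `xy` and connection of its ends, a path
from `x` to `y`. -/
theorem exists_closing {P : List W} (hP : P.Nodup) {x y : W} (h : s(x, y) ∈ listEdges P) :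
    ∃ p q, p ≠ q ∧ bdry (listChain P) = Finsupp.single p 1 + Finsupp.single q 1 ∧
      ∀ Z : List W, Z.Nodup → (∀ z ∈ Z, z ∉ P) → ∃ P' : List W, P'.Nodup ∧ P' ≠ [] ∧
        listChain P' = listChain P + edgeChain x y + listChain (q :: (Z ++ [p])) := by
  suffices H : ∀ (x y : W) (X Y : List W), P = X ++ x :: y :: Y →
      ∃ p q, p ≠ q ∧ bdry (listChain P) = Finsupp.single p 1 + Finsupp.single q 1 ∧
      ∀ Z : List W, Z.Nodup → (∀ z ∈ Z, z ∉ P) → ∃ P' : List W, P'.Nodup ∧ P' ≠ [] ∧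
        listChain P' = listChain P + edgeChain x y + listChain (q :: (Z ++ [p])) by
    obtain ⟨X, Y, h | h⟩ := exists_append_of_mem_listEdges h
    · exact H x y X Y h
    · rw [edgeChain_comm]
      exact H y x X Y h
  clear h x y
  rintro x y X Y rfl
  obtain ⟨p, X', hX⟩ : ∃ p X', X ++ [x] = p :: X' := by
    cases X with
    | nil => exact ⟨x, [], rfl⟩
    | cons p X => exact ⟨p, X ++ [x], rfl⟩
  obtain ⟨Y', q, hY⟩ : ∃ Y' q, y :: Y = Y' ++ [q] :=
    ⟨(y :: Y).dropLast, (y :: Y).getLast (by simp), by rw [List.dropLast_append_getLast]⟩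
  have e : X ++ x :: y :: Y = p :: ((X' ++ Y') ++ [q]) := by
    rw [show X ++ x :: y :: Y = (X ++ [x]) ++ (y :: Y) by simp, hX, hY]; simp
  have hc : listChain (X ++ x :: y :: Y) =
      listChain (p :: X') + edgeChain x y + listChain (Y' ++ [q]) := by
    rw [listChain_append_cons, hX, listChain_cons_cons, hY, add_assoc]
  -- The old path runs from `p` to `x`, then from `y` to `q`. The new one runs from `y` to `q`,
  -- through `Z` to `p`, and on to `x`.
  refine ⟨p, q, ?_, ?_, fun Z hZ hd => ⟨(Y' ++ [q]) ++ (Z ++ (p :: X')), ?_, by simp, ?_⟩⟩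
  · rw [e, List.nodup_cons] at hP
    rintro rfl
    exact hP.1 (by simp)
  · rw [e, bdry_listChain_cons_concat]
  · have hpm : ((Y' ++ [q]) ++ (Z ++ (p :: X'))).Perm (Z ++ (X ++ x :: y :: Y)) := by
      rw [show X ++ x :: y :: Y = (p :: X') ++ (Y' ++ [q]) by rw [e]; simp]
      refine (List.perm_append_comm_assoc _ _ _).trans (List.Perm.append_left _ ?_)
      exact List.perm_append_comm
    rw [hpm.nodup_iff, List.nodup_append]
    exact ⟨hZ, hP, fun a ha b hb hab => hd a ha (hab ▸ hb)⟩
  · rw [hc, List.append_assoc, List.singleton_append, listChain_append_cons,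
      show q :: (Z ++ p :: X') = (q :: Z) ++ p :: X' by simp, listChain_append_cons (q :: Z),
      List.cons_append]
    have h2 := ZModModule.add_self (edgeChain x y)
    calc _ = listChain (p :: X') + listChain (Y' ++ [q]) + listChain (q :: (Z ++ [p])) + 0 := by
          abel
      _ = _ := by rw [← h2]; abel

end Chains

/-! ### Families of coloured path systems: merging the paths of each colour. -/

section Families

variable {W ι : Type*}

theorem sum_update_eq_add [DecidableEq ι] {β M : Type*} [AddCommGroup M] {I : Finset ι}
    (g : β → M) (L : ι → β) {i : ι} (hi : i ∈ I) {T : β} {Δ : M} (h : g T = g (L i) + Δ) :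
    ∑ k ∈ I, g (Function.update L i T k) = ∑ k ∈ I, g (L k) + Δ := by
  rw [← Finset.add_sum_erase _ _ hi, ← Finset.add_sum_erase I (fun k => g (L k)) hi,
    Function.update_self, h, Finset.sum_congr rfl fun k hk => by
      rw [Function.update_of_ne (Finset.ne_of_mem_erase hk)]]
  abel

theorem sum_update_of_notMem [DecidableEq ι] {β M : Type*} [AddCommGroup M] {I : Finset ι}
    (g : β → M) (L : ι → β) {i : ι} (hi : i ∉ I) (T : β) :
    ∑ k ∈ I, g (Function.update L i T k) = ∑ k ∈ I, g (L k) :=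
  Finset.sum_congr rfl fun k hk => by
    rw [Function.update_of_ne (by rintro rfl; exact hi hk)]

theorem sum_length_update [DecidableEq ι] {I : Finset ι} {L : ι → List (List W)} {i : ι}
    {T : List (List W)} (h : T.length = (L i).length) :
    ∑ k ∈ I, (Function.update L i T k).length = ∑ k ∈ I, (L k).length :=
  Finset.sum_congr rfl fun k _ => by
    rcases eq_or_ne k i with rfl | hk
    · rw [Function.update_self, h]
    · rw [Function.update_of_ne hk]

/-- The family `L'` of path systems arises from `L` by adding edges, the sum of which over the
colours in `I` is `Δ`. -/
structure Grows (I : Finset ι) (L L' : ι → List (List W)) (Δ : Sym2 W →₀ ZMod 2) : Prop where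
  sys : ∀ i, IsPathSystem (L' i)
  chain : ∑ i ∈ I, sysChain (L' i) = ∑ i ∈ I, sysChain (L i) + Δ
  edges : ∀ i, sysEdges (L i) ⊆ sysEdges (L' i)

theorem Grows.refl (I : Finset ι) {L : ι → List (List W)} (hL : ∀ i, IsPathSystem (L i)) :
    Grows I L L 0 :=
  ⟨hL, by simp, fun _ => List.Subset.refl _⟩

theorem Grows.trans {I : Finset ι} {L L' L'' : ι → List (List W)} {Δ Δ' : Sym2 W →₀ ZMod 2}
    (h : Grows I L L' Δ) (h' : Grows I L' L'' Δ') : Grows I L L'' (Δ + Δ') :=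
  ⟨h'.sys, by rw [h'.chain, h.chain, add_assoc], fun i => List.Subset.trans (h.edges i) (h'.edges i)⟩

theorem Grows.update [DecidableEq ι] {I : Finset ι} {L L' : ι → List (List W)}
    {Δ Δ' : Sym2 W →₀ ZMod 2} (h : Grows I L L' Δ) {i : ι} (hi : i ∈ I) {T : List (List W)}
    (hT : IsPathSystem T) (hc : sysChain T = sysChain (L' i) + Δ')
    (he : sysEdges (L' i) ⊆ sysEdges T) : Grows I L (Function.update L' i T) (Δ + Δ') := by
  refine h.trans ⟨fun k => ?_, sum_update_eq_add _ _ hi hc, fun k => ?_⟩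
  · rcases eq_or_ne k i with rfl | hk
    · rwa [Function.update_self]
    · rw [Function.update_of_ne hk]; exact h.sys k
  · rcases eq_or_ne k i with rfl | hk
    · rwa [Function.update_self]
    · rw [Function.update_of_ne hk]; exact List.Subset.refl _

/-- The boundaries at `v` add up to zero over all colours, so one nonzero term forces another. -/
theorem exists_partner {I : Finset ι} {L : ι → List (List W)}
    (h : bdry (∑ i ∈ I, sysChain (L i)) = 0) {i : ι} (hi : i ∈ I) {v : W}
    (hv : bdry (sysChain (L i)) v ≠ 0) : ∃ j ∈ I, j ≠ i ∧ bdry (sysChain (L j)) v ≠ 0 := by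
  by_contra! hcon
  rw [map_sum] at h
  have := DFunLike.congr_fun h v
  rw [Finsupp.finsetSum_apply, Finset.sum_eq_single_of_mem i hi hcon] at this
  exact hv this

theorem exists_fresh [Infinite W] [Finite ι] (L : ι → List (List W)) (S : List W) :
    ∃ z, z ∉ S ∧ ∀ i, z ∉ (L i).flatten := by
  classical
  have := Fintype.ofFinite ι
  obtain ⟨z, hz⟩ := Infinite.exists_notMem_finset
    (S.toFinset ∪ Finset.univ.biUnion fun i => (L i).flatten.toFinset)
  rw [Finset.mem_union, not_or, List.mem_toFinset] at hz
  exact ⟨z, hz.1, fun i hi => hz.2 (Finset.mem_biUnion.mpr ⟨i, by simp, by simpa using hi⟩)⟩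

/-- In a path system with three distinct ends, the first of them lies on another path than one of
the others. -/
theorem IsPathSystem.exists_join_of_three {T : List (List W)} (hT : IsPathSystem T)
    {a b₁ b₂ z : W} (h₁ : a ≠ b₁) (h₂ : a ≠ b₂) (h₃ : b₁ ≠ b₂)
    (ha : bdry (sysChain T) a ≠ 0) (hb₁ : bdry (sysChain T) b₁ ≠ 0)
    (hb₂ : bdry (sysChain T) b₂ ≠ 0) (hz : z ∉ T.flatten) :
    ∃ b, (b = b₁ ∨ b = b₂) ∧ ∃ T', IsPathSystem T' ∧
      sysChain T' = sysChain T + (edgeChain a z + edgeChain b z) ∧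
      T'.length + 1 = T.length ∧ sysEdges T ⊆ sysEdges T' := by
  obtain ⟨p, M, R, h1, h2, h3, h4, h5⟩ := hT.exists_concat_cons ha
  have hz' : z ∉ ((p :: (M ++ [a])) :: R).flatten := by
    rw [List.flatten_cons, h3.mem_iff]; exact hz
  have hpa : p ≠ a := by
    rintro rfl
    exact (List.nodup_cons.mp h1.head_nodup).1 (by simp)
  have hae : bdry (listChain (p :: (M ++ [a]))) a ≠ 0 := by
    rw [bdry_listChain_cons_concat]
    simp [hpa]
  have key : ∀ b, b ≠ a → b ≠ p → bdry (sysChain T) b ≠ 0 → bdry (sysChain R) b ≠ 0 := by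
    intro b hba hbp hb
    rw [← h4, map_add, Finsupp.add_apply, bdry_listChain_cons_concat] at hb
    simpa [hba.symm, hbp.symm, Finsupp.single_apply] using hb
  have fin : ∀ b, bdry (sysChain R) b ≠ 0 → ∃ T', IsPathSystem T' ∧
      sysChain T' = sysChain T + (edgeChain a z + edgeChain b z) ∧
      T'.length + 1 = T.length ∧ sysEdges T ⊆ sysEdges T' := by
    intro b hb
    obtain ⟨T', g1, g2, g3, g4⟩ := h1.exists_join hae hb hz'
    refine ⟨T', g1, ?_, ?_, fun e he => g4 ?_⟩
    · rw [g2, sysChain_cons, h4]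
    · rw [g3, List.length_cons, h2]
    · rw [sysEdges_cons]; exact h5.mem_iff.mpr he
  -- The path ending in `a` has only one other end `p`, so one of `b₁`, `b₂` is an end of another
  -- path.
  by_cases hp : b₁ = p
  · exact ⟨b₂, Or.inr rfl, fin _ (key _ h₂.symm (fun h => h₃ (hp.trans h.symm)) hb₂)⟩
  · exact ⟨b₁, Or.inl rfl, fin _ (key _ h₁.symm hp hb₁)⟩

/-- One step of merging two paths of the same colour. -/
theorem exists_merge_step [Infinite W] [Finite ι] (I : Finset ι) (L : ι → List (List W))
    (hL : ∀ i, IsPathSystem (L i)) (hb : bdry (∑ i ∈ I, sysChain (L i)) = 0)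
    {i : ι} (hi : i ∈ I) (hlen : 2 ≤ (L i).length) :
    ∃ L', Grows I L L' 0 ∧ ∑ i ∈ I, (L' i).length < ∑ i ∈ I, (L i).length := by
  classical
  obtain ⟨A, B, R, hi'⟩ : ∃ A B R, L i = A :: B :: R := by
    rcases h : L i with _ | ⟨A, _ | ⟨B, R⟩⟩
    · simp [h] at hlen
    · simp [h] at hlen
    · exact ⟨A, B, R, rfl⟩
  have hs : IsPathSystem (A :: B :: R) := hi' ▸ hL i
  obtain ⟨p, M, a, hA⟩ := exists_eq_cons_concat (hs.two_le A (by simp))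
  obtain ⟨b₁, N, b₂, hB⟩ := exists_eq_cons_concat (hs.two_le B (by simp))
  have hpa : p ≠ a := by
    rintro rfl
    have := hs.head_nodup
    rw [hA] at this
    exact (List.nodup_cons.mp this).1 (by simp)
  have hbb : b₁ ≠ b₂ := by
    rintro rfl
    have := hs.tail.head_nodup
    rw [hB] at this
    exact (List.nodup_cons.mp this).1 (by simp)
  have hae : bdry (listChain A) a ≠ 0 := by
    rw [hA, bdry_listChain_cons_concat]; simp [hpa]
  have haR : a ∉ (B :: R).flatten := hs.disjoint (by rw [hA]; simp)
  have haT : bdry (sysChain (L i)) a ≠ 0 := by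
    rwa [hi', sysChain_cons, map_add, Finsupp.add_apply, bdry_sysChain_eq_zero_of_notMem haR,
      add_zero]
  have hBb : ∀ b ∈ B, b ≠ a ∧ b ∉ A := fun b hb => ⟨fun h => haR (by simp [← h, hb]),
    fun h => hs.disjoint h (by simp [hb])⟩
  have hends : ∀ b ∈ B, bdry (listChain B) b ≠ 0 →
      bdry (sysChain (B :: R)) b ≠ 0 ∧ bdry (sysChain (L i)) b ≠ 0 := by
    intro b hbB hb
    have h1 : bdry (sysChain (B :: R)) b ≠ 0 := by
      rwa [sysChain_cons, map_add, Finsupp.add_apply,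
        bdry_sysChain_eq_zero_of_notMem (hs.tail.disjoint hbB), add_zero]
    refine ⟨h1, ?_⟩
    rwa [hi', sysChain_cons, map_add, Finsupp.add_apply,
      bdry_listChain_eq_zero_of_notMem (hBb b hbB).2, zero_add]
  have hb₁B : b₁ ∈ B := by rw [hB]; simp
  have hb₂B : b₂ ∈ B := by rw [hB]; simp
  have hb₁ := hends b₁ hb₁B (by rw [hB, bdry_listChain_cons_concat]; simp [hbb.symm])
  have hb₂ := hends b₂ hb₂B (by rw [hB, bdry_listChain_cons_concat]; simp [hbb])
  obtain ⟨z, -, hz⟩ := exists_fresh L []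
  obtain ⟨j, hj, hji, hja⟩ := exists_partner hb hi haT
  have hjoin : ∀ b, bdry (sysChain (B :: R)) b ≠ 0 → ∃ T', IsPathSystem T' ∧
      sysChain T' = sysChain (L i) + (edgeChain a z + edgeChain b z) ∧
      T'.length + 1 = (L i).length ∧ sysEdges (L i) ⊆ sysEdges T' := by
    intro b hb
    have hzi := hz i
    rw [hi'] at hzi ⊢
    exact hs.exists_join hae hb hzi
  -- The join in colour `i` adds `az` and `bz`, which have to be added once more elsewhere. If `a`
  -- and `b` are ends in different further colours `j` and `l`, each of these is just extended to
  -- `z`.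
  by_cases hdiff : ∃ b, bdry (sysChain (B :: R)) b ≠ 0 ∧
      ∃ l ∈ I, l ≠ i ∧ l ≠ j ∧ bdry (sysChain (L l)) b ≠ 0
  · obtain ⟨b, hb, l, hl, hli, hlj, hlb⟩ := hdiff
    obtain ⟨Ti, h1, h2, h3, h4⟩ := hjoin b hb
    obtain ⟨Tj, g1, g2, g3, -, g4⟩ := (hL j).exists_extend hja (hz j)
    obtain ⟨Tl, f1, f2, f3, -, f4⟩ := (hL l).exists_extend hlb (hz l)
    have G1 := (Grows.refl I hL).update hi h1 h2 h4
    have G2 := G1.update (i := j) (T := Tj) (Δ' := edgeChain a z) hj g1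
      (by rw [Function.update_of_ne hji, g2]) (by rwa [Function.update_of_ne hji])
    have e : Function.update (Function.update L i Ti) j Tj l = L l := by
      rw [Function.update_of_ne hlj, Function.update_of_ne hli]
    have G3 := G2.update (i := l) (T := Tl) (Δ' := edgeChain b z) hl f1
      (by rw [e, f2]) (by rwa [e])
    rw [zero_add, add_assoc, ZModModule.add_self] at G3
    refine ⟨_, G3, ?_⟩
    · rw [sum_length_update (by rw [e, f3]), sum_length_update
        (by rw [Function.update_of_ne hji, g3])]
      refine Finset.sum_lt_sum (fun k _ => ?_) ⟨i, hi, ?_⟩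
      · rcases eq_or_ne k i with rfl | hk
        · rw [Function.update_self]; omega
        · rw [Function.update_of_ne hk]
      · rw [Function.update_self]; omega
  -- Otherwise `j` is the only partner colour of the remaining ends, so `a`, `b₁`, `b₂` are all ends
  -- in colour `j`, and a join through `z` is possible in that colour as well.
  · push Not at hdiff
    have hall : ∀ b, bdry (sysChain (B :: R)) b ≠ 0 → bdry (sysChain (L i)) b ≠ 0 →
        bdry (sysChain (L j)) b ≠ 0 := by
      intro b h1 h2
      obtain ⟨l, hl, hli, hlb⟩ := exists_partner hb hi h2
      rcases eq_or_ne l j with rfl | hlj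
      · exact hlb
      · exact absurd (hdiff b h1 l hl hli hlj) hlb
    obtain ⟨b, hbc, Tj, g1, g2, g3, g4⟩ := (hL j).exists_join_of_three
      (hBb b₁ hb₁B).1.symm (hBb b₂ hb₂B).1.symm hbb hja (hall b₁ hb₁.1 hb₁.2)
      (hall b₂ hb₂.1 hb₂.2) (hz j)
    have hbR : bdry (sysChain (B :: R)) b ≠ 0 := by
      rcases hbc with rfl | rfl
      · exact hb₁.1
      · exact hb₂.1
    obtain ⟨Ti, h1, h2, h3, h4⟩ := hjoin b hbR
    have G1 := (Grows.refl I hL).update hi h1 h2 h4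
    have G2 := G1.update (i := j) (T := Tj) hj g1
      (by rw [Function.update_of_ne hji, g2]) (by rwa [Function.update_of_ne hji])
    rw [zero_add, ZModModule.add_self] at G2
    refine ⟨_, G2, ?_⟩
    · refine Finset.sum_lt_sum (fun k _ => ?_) ⟨i, hi, ?_⟩
      · rcases eq_or_ne k j with rfl | hkj
        · rw [Function.update_self]; omega
        · rw [Function.update_of_ne hkj]
          rcases eq_or_ne k i with rfl | hk
          · rw [Function.update_self]; omega
          · rw [Function.update_of_ne hk]
      · rw [Function.update_of_ne hji.symm, Function.update_self]; omega

/-- If every vertex is an end of an even number of paths, then all paths of the same colour can be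
merged without changing the sum of all colours. -/
theorem exists_merged [Infinite W] [Finite ι] (I : Finset ι) (L : ι → List (List W))
    (hL : ∀ i, IsPathSystem (L i)) (hb : bdry (∑ i ∈ I, sysChain (L i)) = 0) :
    ∃ L', Grows I L L' 0 ∧ ∀ i ∈ I, (L' i).length ≤ 1 := by
  induction hn : ∑ i ∈ I, (L i).length using Nat.strong_induction_on generalizing L with
  | _ n ih =>
    by_cases h : ∀ i ∈ I, (L i).length ≤ 1
    · exact ⟨L, Grows.refl I hL, h⟩
    · push Not at h
      obtain ⟨i, hi, hlen⟩ := h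
      obtain ⟨L₁, G₁, hlt⟩ := exists_merge_step I L hL hb hi hlen
      obtain ⟨L₂, G₂, h₂⟩ := ih _ (hn ▸ hlt) L₁ G₁.sys (by rw [G₁.chain, add_zero, hb]) rfl
      exact ⟨L₂, by simpa using G₁.trans G₂, h₂⟩

end Families

/-! ### Removing the dummy edges. -/

section Closing

variable {W ι : Type*}

theorem eq_of_bdry_ne_zero {p q v : W}
    (h : (Finsupp.single p 1 + Finsupp.single q 1 : W →₀ ZMod 2) v ≠ 0) : v = p ∨ v = q := by
  classical
  by_contra! hcon
  rw [Finsupp.add_apply, Finsupp.single_apply, Finsupp.single_apply, if_neg hcon.1.symm,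
    if_neg hcon.2.symm] at h
  simp at h

theorem exists_eq_singleton_of_mem_sysEdges {T : List (List W)} (h : T.length ≤ 1) {e : Sym2 W}
    (he : e ∈ sysEdges T) : ∃ P, T = [P] ∧ e ∈ listEdges P := by
  rcases T with _ | ⟨P, _ | ⟨Q, T⟩⟩
  · simp at he
  · exact ⟨P, rfl, by simpa using he⟩
  · simp at h

theorem add_eq_of_sum_eq {M : Type*} [AddCommGroup M] [Module (ZMod 2) M] {a b c : M}
    (h : a + b = c) : b = c + a := by
  rw [← h, add_comm a b, add_assoc, ZModModule.add_self, add_zero]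

/-- The colours in `K` carry a dummy edge each. Unless there is exactly one colour without a dummy
edge, the colours can be rearranged so that each is a single path and the dummy edges are gone. -/
theorem exists_paths [Infinite W] [Finite ι] (x y : ι → W) (I K : Finset ι) (hKI : K ⊆ I)
    (hcard : (I.card : ℤ) - K.card ≠ 1) (L : ι → List (List W)) (hL : ∀ i, IsPathSystem (L i))
    (hK : ∀ i ∈ K, s(x i, y i) ∈ sysEdges (L i)) (hb : bdry (∑ i ∈ I, sysChain (L i)) = 0) :
    ∃ P : ι → List W, (∀ i, (P i).Nodup ∧ P i ≠ []) ∧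
      ∑ i ∈ I, listChain (P i) =
        ∑ i ∈ I, sysChain (L i) + ∑ i ∈ K, edgeChain (x i) (y i) := by
  classical
  -- Finished colours leave `I` and `K` simultaneously, so the difference in `hcard` is invariant.
  induction hn : K.card using Nat.strong_induction_on generalizing I K L with
  | _ n ih =>
  obtain ⟨L₁, G, hlen⟩ := exists_merged I L hL hb
  rw [← add_zero (∑ i ∈ I, sysChain (L i)), ← G.chain]
  replace hb : bdry (∑ i ∈ I, sysChain (L₁ i)) = 0 := by rw [G.chain, add_zero, hb]
  -- Merging only adds edges to each colour, so the dummy edges survive it.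
  replace hK : ∀ i ∈ K, s(x i, y i) ∈ sysEdges (L₁ i) := fun i hi => G.edges i (hK i hi)
  replace hL := G.sys
  clear G
  rename' L => L₀, L₁ => L
  rcases K.eq_empty_or_nonempty with rfl | ⟨i, hiK⟩
  -- No dummy edges are left: each colour in `I` is a single path or empty, and an empty one is
  -- represented by the one-vertex path at `w`.
  · obtain ⟨w⟩ : Nonempty W := inferInstance
    have : ∀ i, ∃ P : List W, (P.Nodup ∧ P ≠ []) ∧ (i ∈ I → listChain P = sysChain (L i)) := by
      intro i
      by_cases hi : i ∈ I
      · have h1 := hlen i hi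
        have h2 := hL i
        rcases h : L i with _ | ⟨P, _ | ⟨Q, T⟩⟩
        · exact ⟨[w], by simp⟩
        · rw [h] at h2
          have := h2.two_le P (by simp)
          exact ⟨P, ⟨h2.head_nodup, by rintro rfl; simp at this⟩, by simp⟩
        · simp [h] at h1
      · exact ⟨[w], by simp [hi]⟩
    choose P h1 h2 using this
    exact ⟨P, h1, by rw [Finset.sum_empty, add_zero]; exact Finset.sum_congr rfl h2⟩
  have hiI := hKI hiK
  obtain ⟨P, hP, hPe⟩ := exists_eq_singleton_of_mem_sysEdges (hlen i hiI) (hK i hiK)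
  have hPs : IsPathSystem [P] := hP ▸ hL i
  obtain ⟨p, q, hpq, hPb, hclose⟩ := exists_closing hPs.head_nodup hPe
  have hPc : sysChain (L i) = listChain P := by simp [hP]
  have hsumI := Finset.add_sum_erase I (fun k => sysChain (L k)) hiI
  have hsumK := Finset.add_sum_erase K (fun k => edgeChain (x k) (y k)) hiK
  have hbe : bdry (∑ k ∈ I.erase i, sysChain (L k)) =
      Finsupp.single p 1 + Finsupp.single q 1 := by
    rw [← hsumI, map_add, hPc, hPb] at hb
    rw [add_eq_of_sum_eq hb, zero_add]
  have hcI := Finset.card_erase_add_one hiI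
  have hcK := Finset.card_erase_add_one hiK
  -- it suffices to extend the other colours by a connection between the ends of the path
  have finish : ∀ (L' : ι → List (List W)) (Z : List W), Z.Nodup → (∀ z ∈ Z, z ∉ P) →
      Grows (I.erase i) L L' (listChain (q :: (Z ++ [p]))) →
      ∃ P : ι → List W, (∀ i, (P i).Nodup ∧ P i ≠ []) ∧
      ∑ i ∈ I, listChain (P i) =
        ∑ i ∈ I, sysChain (L i) + ∑ i ∈ K, edgeChain (x i) (y i) := by
    intro L' Z hZ hZP G
    obtain ⟨P', hP'n, hP'0, hP'c⟩ := hclose Z hZ hZP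
    -- Colour `i` is finished. Taking it out left the boundary `p + q`, which the connection from
    -- `q` to `p` in the other colours cancels, so the induction hypothesis applies to them.
    obtain ⟨R, hR, hRc⟩ := ih (K.erase i).card (by omega) (I.erase i) (K.erase i)
      (Finset.erase_subset_erase _ hKI) (by omega) L' G.sys
      (fun k hk => G.edges k (hK k (Finset.mem_of_mem_erase hk)))
      (by
        rw [G.chain, map_add, bdry_listChain_cons_concat, hbe,
          add_comm (Finsupp.single q _), ZModModule.add_self]) rfl
    refine ⟨Function.update R i P', fun k => ?_, ?_⟩
    · rcases eq_or_ne k i with rfl | hk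
      · rw [Function.update_self]; exact ⟨hP'n, hP'0⟩
      · rw [Function.update_of_ne hk]; exact hR k
    · rw [← Finset.add_sum_erase I _ hiI, sum_update_of_notMem _ _ (Finset.notMem_erase i I),
        Function.update_self, hRc, G.chain, hP'c, ← hsumI, ← hsumK, hPc]
      have := ZModModule.add_self (listChain (q :: (Z ++ [p])))
      calc _ = listChain P + ∑ k ∈ I.erase i, sysChain (L k) + (edgeChain (x i) (y i) +
            ∑ k ∈ K.erase i, edgeChain (x k) (y k)) +
            (listChain (q :: (Z ++ [p])) + listChain (q :: (Z ++ [p]))) := by abel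
        _ = _ := by rw [this, add_zero]
  have hip : bdry (sysChain (L i)) p ≠ 0 := by rw [hPc, hPb]; simp [hpq.symm]
  have hiq : bdry (sysChain (L i)) q ≠ 0 := by rw [hPc, hPb]; simp [hpq]
  obtain ⟨j, hjI, hji, hjp⟩ := exists_partner hb hiI hip
  obtain ⟨l, hlI, hli, hlq⟩ := exists_partner hb hiI hiq
  obtain ⟨z, -, hz⟩ := exists_fresh L []
  have hzP : z ∉ P := fun h => hz i (by simp [hP, h])
  have hjI' : j ∈ I.erase i := Finset.mem_erase.mpr ⟨hji, hjI⟩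
  have hlI' : l ∈ I.erase i := Finset.mem_erase.mpr ⟨hli, hlI⟩
  have hGL := Grows.refl (I.erase i) hL
  rcases ne_or_eq l j with hlj | rfl
  -- Different partners: the connection is `q z p`, with `pz` added to colour `j` and `qz` to colour
  -- `l`.
  · obtain ⟨Tj, g1, g2, -, -, g4⟩ := (hL j).exists_extend hjp (hz j)
    obtain ⟨Tl, f1, f2, -, -, f4⟩ := (hL l).exists_extend hlq (hz l)
    have G1 := hGL.update hjI' g1 g2 g4
    have G2 := G1.update (i := l) (T := Tl) (Δ' := edgeChain q z) hlI' f1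
      (by rw [Function.update_of_ne hlj, f2]) (by rwa [Function.update_of_ne hlj])
    have e : listChain (q :: ([z] ++ [p])) = 0 + edgeChain p z + edgeChain q z := by
      simp [edgeChain_comm z p, add_comm]
    rw [← e] at G2
    exact finish _ [z] (by simp) (by simpa using hzP) G2
  · -- both ends of the path are ends of the same other colour
    by_cases hlK : l ∈ K
    -- Colour `l` is a single path with the same ends `p` and `q` and has a dummy edge of its own.
    -- Both colours are closed through the same `z`, the two connections cancel, and both colours
    -- are finished.
    · obtain ⟨Q, hQ, hQe⟩ := exists_eq_singleton_of_mem_sysEdges (hlen l hlI) (hK l hlK)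
      have hQs : IsPathSystem [Q] := hQ ▸ hL l
      obtain ⟨p', q', hpq', hQb, hclose'⟩ := exists_closing hQs.head_nodup hQe
      have hQc : sysChain (L l) = listChain Q := by simp [hQ]
      rw [hQc, hQb] at hlq hjp
      have hzQ : z ∉ Q := fun h => hz l (by simp [hQ, h])
      obtain ⟨P', hP'n, hP'0, hP'c⟩ := hclose [z] (by simp) (by simpa using hzP)
      obtain ⟨Q', hQ'n, hQ'0, hQ'c⟩ := hclose' [z] (by simp) (by simpa using hzQ)
      have hcc : (Finsupp.single p' (1 : ZMod 2) + Finsupp.single q' 1 =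
            Finsupp.single p 1 + Finsupp.single q 1) ∧
          listChain (q' :: ([z] ++ [p'])) = listChain (q :: ([z] ++ [p])) := by
        rcases eq_of_bdry_ne_zero hjp with rfl | rfl
        · rcases eq_of_bdry_ne_zero hlq with rfl | rfl
          · exact absurd rfl hpq
          · exact ⟨rfl, rfl⟩
        · rcases eq_of_bdry_ne_zero hlq with rfl | rfl
          · refine ⟨add_comm _ _, ?_⟩
            simp only [List.singleton_append, listChain_cons_cons, listChain_singleton, add_zero]
            rw [edgeChain_comm z q, edgeChain_comm p z, add_comm]
          · exact absurd rfl hpq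
      have hlK' : l ∈ K.erase i := Finset.mem_erase.mpr ⟨hli, hlK⟩
      have hcI' := Finset.card_erase_add_one hlI'
      have hcK' := Finset.card_erase_add_one hlK'
      have hsumI' := Finset.add_sum_erase (I.erase i) (fun k => sysChain (L k)) hlI'
      have hsumK' := Finset.add_sum_erase (K.erase i) (fun k => edgeChain (x k) (y k)) hlK'
      obtain ⟨R, hR, hRc⟩ := ih ((K.erase i).erase l).card (by omega) ((I.erase i).erase l)
        ((K.erase i).erase l) (Finset.erase_subset_erase _ (Finset.erase_subset_erase _ hKI))
        (by omega) L hL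
        (fun k hk => hK k (Finset.mem_of_mem_erase (Finset.mem_of_mem_erase hk)))
        (by
          rw [← hsumI', map_add, hQc, hQb, hcc.1] at hbe
          rw [add_eq_of_sum_eq hbe, ZModModule.add_self]) rfl
      refine ⟨Function.update (Function.update R i P') l Q', fun k => ?_, ?_⟩
      · rcases eq_or_ne k l with rfl | hk
        · rw [Function.update_self]; exact ⟨hQ'n, hQ'0⟩
        · rw [Function.update_of_ne hk]
          rcases eq_or_ne k i with rfl | hk
          · rw [Function.update_self]; exact ⟨hP'n, hP'0⟩
          · rw [Function.update_of_ne hk]; exact hR k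
      · rw [← Finset.add_sum_erase I _ hiI, ← Finset.add_sum_erase (I.erase i) _ hlI',
          Function.update_of_ne hli.symm, Function.update_self, Function.update_self,
          sum_update_of_notMem _ _ (Finset.notMem_erase l _),
          sum_update_of_notMem _ _ (fun h => Finset.notMem_erase i I
            (Finset.mem_of_mem_erase h)), hRc, hP'c, hQ'c, ← hsumI, ← hsumI', ← hsumK,
          ← hsumK', hPc, hQc, hcc.2]
        have := ZModModule.add_self (listChain (q :: ([z] ++ [p])))
        calc _ = listChain P + (listChain Q + ∑ k ∈ (I.erase i).erase l, sysChain (L k)) +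
              (edgeChain (x i) (y i) + (edgeChain (x l) (y l) +
              ∑ k ∈ (K.erase i).erase l, edgeChain (x k) (y k))) +
              (listChain (q :: ([z] ++ [p])) + listChain (q :: ([z] ++ [p]))) := by abel
          _ = _ := by rw [this, add_zero]
    · -- a detour through a third colour
      have hlIK : l ∈ I \ K := Finset.mem_sdiff.mpr ⟨hlI, hlK⟩
      have hcs := Finset.card_sdiff_add_card_eq_card hKI
      -- The set `I \ K` contains `l` and, by `hcard`, does not have exactly one element.
      obtain ⟨m, hm, hml⟩ : ∃ m ∈ I \ K, m ≠ l := by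
        refine Finset.exists_mem_ne ?_ l
        have := Finset.card_pos.mpr ⟨l, hlIK⟩
        omega
      rw [Finset.mem_sdiff] at hm
      have hmi : m ≠ i := by rintro rfl; exact hm.2 hiK
      have hmI' : m ∈ I.erase i := Finset.mem_erase.mpr ⟨hmi, hm.1⟩
      obtain ⟨n', hn'z, hn'⟩ := exists_fresh L [z]
      replace hn'z : n' ≠ z := by simpa using hn'z
      have hn'P : n' ∉ P := fun h => hn' i (by simp [hP, h])
      -- The connection `q z p` would close colour `l` to a cycle. Instead `q z n' p` is used:
      -- colour `l` is extended at both ends by `pn'` and `qz`, and colour `m` takes `n'z` as a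
      -- separate path, to be merged later.
      obtain ⟨T₁, g1, g2, -, g3, g4⟩ := (hL l).exists_extend hjp (hn' l)
      have hqn : q ≠ n' := by
        rintro rfl
        exact hlq (bdry_sysChain_eq_zero_of_notMem (hn' l))
      have hlq' : bdry (sysChain T₁) q ≠ 0 := by
        rw [g2, map_add, bdry_edgeChain]
        simpa [hpq, hqn.symm, Finsupp.single_apply] using hlq
      have hzT : z ∉ T₁.flatten := by
        rw [g3.mem_iff, List.mem_cons, not_or]
        exact ⟨hn'z.symm, hz l⟩
      obtain ⟨T₂, f1, f2, -, -, f4⟩ := g1.exists_extend hlq' hzT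
      have G1 := hGL.update (T := T₂) (Δ' := edgeChain p n' + edgeChain q z) hlI' f1
        (by rw [f2, g2, add_assoc]) (fun e he => f4 (g4 he))
      have hTm : IsPathSystem ([n', z] :: L m) := by
        refine ⟨?_, fun B hB => ?_⟩
        · rw [List.flatten_cons, List.nodup_append]
          refine ⟨by simp [hn'z], (hL m).nodup, ?_⟩
          rintro a ha b hb rfl
          simp only [List.mem_cons, List.not_mem_nil, or_false] at ha
          rcases ha with rfl | rfl
          · exact hn' m hb
          · exact hz m hb
        · rcases List.mem_cons.mp hB with rfl | hB
          · simp
          · exact (hL m).two_le B hB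
      have G2 := G1.update (i := m) (T := [n', z] :: L m) (Δ' := edgeChain n' z) hmI' hTm
        (by rw [Function.update_of_ne hml]; simp [add_comm])
        (by rw [Function.update_of_ne hml, sysEdges_cons]; exact List.subset_append_right _ _)
      have e : listChain (q :: ([z, n'] ++ [p])) =
          0 + (edgeChain p n' + edgeChain q z) + edgeChain n' z := by
        simp only [List.cons_append, List.nil_append, listChain_cons_cons, listChain_singleton]
        rw [edgeChain_comm n' p, edgeChain_comm z n']
        abel
      rw [← e] at G2
      exact finish _ [z, n'] (by simp [hn'z.symm]) (by simp [hzP, hn'P]) G2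

end Closing

/-! ### From lists and chains back to graphs, paths and odd-covers. -/

section Transfer

theorem exists_kPath {W : Type*} (l : List W) (hl : l.Nodup) (hne : l ≠ []) :
    ∃ p : KPath W, p.edges = listEdges l := by
  have key : ∀ (l : List W) (a : W), (a :: l).Nodup → ∃ (b : W) (w : (⊤ : SimpleGraph W).Walk a b),
      w.support = a :: l ∧ w.edges = listEdges (a :: l) := by
    intro l
    induction l with
    | nil => exact fun a _ => ⟨a, .nil, rfl, rfl⟩
    | cons b l ih =>
      intro a h
      obtain ⟨c, w, h1, h2⟩ := ih b h.of_cons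
      have hab : a ≠ b := by
        rintro rfl
        exact (List.nodup_cons.mp h).1 (by simp)
      exact ⟨c, .cons hab w, by rw [SimpleGraph.Walk.support_cons, h1],
        by rw [SimpleGraph.Walk.edges_cons, h2, listEdges_cons_cons]⟩
  cases l with
  | nil => exact absurd rfl hne
  | cons a l =>
    obtain ⟨b, w, h1, h2⟩ := key l a hl
    exact ⟨⟨a, b, ⟨w, by rw [SimpleGraph.Walk.isPath_def, h1]; exact hl⟩⟩, h2⟩

theorem listEdges_map {V W : Type*} (f : V → W) (l : List V) :
    listEdges (l.map f) = (listEdges l).map (Sym2.map f) := by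
  induction l with
  | nil => simp
  | cons a l ih => cases l with
    | nil => simp
    | cons b l => simpa using ih

theorem listChain_map {V W : Type*} (f : V → W) (l : List V) :
    listChain (l.map f) = Finsupp.mapDomain (Sym2.map f) (listChain l) := by
  induction l with
  | nil => simp
  | cons a l ih => cases l with
    | nil => simp
    | cons b l =>
      simp only [List.map_cons, listChain_cons_cons, Finsupp.mapDomain_add] at ih ⊢
      rw [ih]
      simp [edgeChain, Finsupp.mapDomain_single]

theorem bdry_mapDomain {V W : Type*} (f : V → W) (c : Sym2 V →₀ ZMod 2) :
    bdry (Finsupp.mapDomain (Sym2.map f) c) = Finsupp.mapDomain f (bdry c) := by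
  induction c using Finsupp.induction_linear with
  | zero => simp
  | add a b ha hb => simp [Finsupp.mapDomain_add, ha, hb]
  | single e x =>
    induction e with
    | _ u v => simp [bdry, Finsupp.mapDomain_single, Finsupp.mapDomain_add]

variable {V : Type*}

/-- The chain of the edges of a finite graph. -/
noncomputable def graphChain [Finite V] (G : SimpleGraph V) : Sym2 V →₀ ZMod 2 :=
  Finsupp.equivFunOnFinite.symm (G.edgeSet.indicator 1)

theorem graphChain_apply [Finite V] (G : SimpleGraph V) (e : Sym2 V) [Decidable (e ∈ G.edgeSet)] :
    graphChain G e = if e ∈ G.edgeSet then 1 else 0 := by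
  simp [graphChain, Set.indicator_apply]

theorem graphChain_bot [Finite V] : graphChain (⊥ : SimpleGraph V) = 0 := by
  classical
  ext e
  rw [graphChain_apply]
  simp

/-- The chain of the edges of a graph on `V`, seen in the vertex set `V ⊕ ℕ`. -/
noncomputable def graphChainSum [Finite V] (G : SimpleGraph V) : Sym2 (V ⊕ ℕ) →₀ ZMod 2 :=
  Finsupp.mapDomain (Sym2.map Sum.inl) (graphChain G)

theorem bdry_graphChain [Fintype V] (G : SimpleGraph V) [DecidableRel G.Adj] (v : V) :
    bdry (graphChain G) v = G.degree v := by
  classical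
  have h : graphChain G = ∑ e ∈ G.edgeFinset, Finsupp.single e 1 := by
    ext e
    rw [graphChain_apply, Finsupp.finsetSum_apply]
    simp [Finsupp.single_apply]
  have h2 : ∀ e ∈ G.edgeFinset, bdry (Finsupp.single e 1) v = if v ∈ e then 1 else 0 := by
    intro e he
    induction e with
    | _ a b =>
      have hab : a ≠ b := G.ne_of_adj (by simpa using he)
      rw [← edgeChain, bdry_edgeChain, Finsupp.add_apply, Finsupp.single_apply,
        Finsupp.single_apply]
      simp only [Sym2.mem_iff]
      rcases eq_or_ne a v with rfl | ha
      · simp [hab.symm]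
      · rcases eq_or_ne b v with rfl | hb
        · simp [ha]
        · simp [ha, hb, ha.symm, hb.symm]
  rw [h, map_sum, Finsupp.finsetSum_apply, Finset.sum_congr rfl h2, Finset.sum_boole,
    ← G.incidenceFinset_eq_filter, G.card_incidenceFinset_eq_degree]

theorem bdry_graphChainSum [Fintype V] (G : SimpleGraph V) [DecidableRel G.Adj] :
    bdry (graphChainSum G) =
      ∑ v ∈ Finset.univ.filter (fun v : V => Odd (G.degree v)), Finsupp.single (Sum.inl v) 1 := by
  classical
  have h : bdry (graphChain G) =
      ∑ v ∈ Finset.univ.filter (fun v : V => Odd (G.degree v)), Finsupp.single v 1 := by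
    ext v
    rw [bdry_graphChain, Finsupp.finsetSum_apply]
    simp only [Finsupp.single_apply, Finset.sum_ite_eq', Finset.mem_filter, Finset.mem_univ,
      true_and]
    split_ifs with h
    · exact (ZMod.natCast_eq_one_iff_odd).mpr h
    · exact (ZMod.natCast_eq_zero_iff_even).mpr (Nat.not_odd_iff_even.mp h)
  rw [graphChainSum, bdry_mapDomain, h, Finsupp.mapDomain_finsetSum]
  simp [Finsupp.mapDomain_single]

/-- Finitely many paths use only finitely many of the added vertices, so they live in `V ⊕ Fin m`
for some `m`. The coefficient of an edge in the sum of the chains is the parity of the number of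
paths through it. -/
theorem pathOddCoverNumberIso_le [Finite V] (G : SimpleGraph V) {ι : Type*} [Fintype ι]
    (P : ι → List (V ⊕ ℕ)) (hP : ∀ i, (P i).Nodup ∧ P i ≠ [])
    (h : ∑ i, listChain (P i) = graphChainSum G) :
    pathOddCoverNumberIso G ≤ Fintype.card ι := by
  classical
  obtain ⟨m, hm⟩ : ∃ m, ∀ i, ∀ n, Sum.inr n ∈ P i → n < m := by
    refine ⟨((Finset.univ.biUnion fun i => (P i).toFinset).preimage Sum.inr
      Sum.inr_injective.injOn).sup id + 1, fun i n hn => Nat.lt_succ_of_le ?_⟩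
    refine Finset.le_sup (f := id) ?_
    simp only [Finset.mem_preimage, Finset.mem_biUnion, List.mem_toFinset]
    exact ⟨i, by simp, hn⟩
  let f : V ⊕ Fin m → V ⊕ ℕ := Sum.map id Fin.val
  have hf : Function.Injective f := Sum.map_injective.mpr ⟨Function.injective_id, Fin.val_injective⟩
  have hQ : ∀ i, ∃ Q : List (V ⊕ Fin m), Q.map f = P i := by
    intro i
    have : P i ∈ Set.range (List.map f) := by
      rw [Set.range_list_map]
      rintro (v | n) hv
      · exact ⟨Sum.inl v, rfl⟩
      · exact ⟨Sum.inr ⟨n, hm i n hv⟩, rfl⟩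
    exact this
  choose Q hQ using hQ
  have hp : ∀ i, ∃ p : KPath (V ⊕ Fin m), p.edges = listEdges (Q i) := by
    intro i
    refine exists_kPath _ (List.Nodup.of_map f (hQ i ▸ (hP i).1)) ?_
    rintro h0
    exact (hP i).2 (by rw [← hQ i, h0]; rfl)
  choose p hp using hp
  have hmem : ∀ i e, e ∈ listEdges (Q i) ↔ Sym2.map f e ∈ listEdges (P i) := by
    intro i e
    rw [← hQ i, listEdges_map, List.mem_map_of_injective (Sym2.map.injective hf)]
  have hG : ∀ e : Sym2 (V ⊕ Fin m), graphChainSum G (Sym2.map f e) =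
      if e ∈ (G ⊕g (⊥ : SimpleGraph (Fin m))).edgeSet then 1 else 0 := by
    intro e
    have hinl : Function.Injective (Sym2.map (Sum.inl : V → V ⊕ ℕ)) :=
      Sym2.map.injective Sum.inl_injective
    have hnot : ∀ (a : V ⊕ ℕ) (n : ℕ), graphChainSum G s(a, Sum.inr n) = 0 := by
      intro a n
      refine Finsupp.mapDomain_of_notMem_range _ _ ?_
      rintro ⟨e, he⟩
      have : Sum.inr n ∈ Sym2.map (Sum.inl : V → V ⊕ ℕ) e := by rw [he]; simp
      simp at this
    induction e with
    | _ a b =>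
      rcases b with v | n
      · rcases a with u | k
        · have : Sym2.map f s(Sum.inl u, Sum.inl v) = Sym2.map Sum.inl s(u, v) := rfl
          rw [this, graphChainSum, Finsupp.mapDomain_apply hinl, graphChain_apply]
          simp
        · have : Sym2.map f s(Sum.inr k, Sum.inl v) = s(Sum.inl v, Sum.inr k.val) :=
            Sym2.eq_swap
          rw [this, hnot]
          simp
      · have : Sym2.map f s(a, Sum.inr n) = s(f a, Sum.inr n.val) := rfl
        rw [this, hnot]
        rcases a with u | k <;> simp
  refine le_trans (Nat.sInf_le (m := pathOddCoverNumber (G ⊕g (⊥ : SimpleGraph (Fin m)))) ⟨m, rfl⟩)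
    (Nat.sInf_le ?_)
  let φ := Fintype.equivFin ι
  refine ⟨fun i => p (φ.symm i), fun e => ?_⟩
  have h1 := DFunLike.congr_fun h (Sym2.map f e)
  rw [hG, Finsupp.finsetSum_apply] at h1
  simp_rw [fun i => listChain_apply (hP i).1 (Sym2.map f e)] at h1
  have h2 : {i : Fin (Fintype.card ι) | e ∈ (p (φ.symm i)).edges}.ncard =
      (Finset.univ.filter fun i => Sym2.map f e ∈ listEdges (P i)).card := by
    have : {i : Fin (Fintype.card ι) | e ∈ (p (φ.symm i)).edges} =
        φ '' ((Finset.univ.filter fun i => Sym2.map f e ∈ listEdges (P i) : Finset ι) : Set ι) := by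
      ext i
      simp [hp, hmem]
    rw [this, Set.ncard_image_of_injective _ φ.injective, Set.ncard_coe_finset]
  rw [h2, ← ZMod.natCast_eq_one_iff_odd]
  rw [Finset.sum_boole] at h1
  rw [h1]
  split_ifs with he <;> simp [he]

end Transfer

/-! ### Linear forests as lists of disjoint paths, and the insertion of dummy edges. -/

section LinearForests

theorem sysChain_eq_sum {W : Type*} (T : List (List W)) :
    sysChain T = ((sysEdges T).map fun e => Finsupp.single e 1).sum := by
  induction T with
  | nil => simp
  | cons A T ih => simp [ih, listChain_eq_sum]

theorem mem_flatten_of_mem_sysEdges {W : Type*} {T : List (List W)} {e : Sym2 W}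
    (he : e ∈ sysEdges T) {v : W} (hv : v ∈ e) : v ∈ T.flatten := by
  obtain ⟨A, hA, he⟩ := List.mem_flatMap.mp he
  exact List.mem_flatten.mpr ⟨A, hA, mem_of_mem_listEdges he hv⟩

theorem nodup_sysEdges {W : Type*} {T : List (List W)} (hT : T.flatten.Nodup) :
    (sysEdges T).Nodup := by
  induction T with
  | nil => simp
  | cons A T ih =>
    rw [List.flatten_cons, List.nodup_append] at hT
    rw [sysEdges_cons, List.nodup_append]
    refine ⟨nodup_listEdges hT.1, ih hT.2.1, ?_⟩
    rintro e he f hf rfl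
    induction e with
    | _ u v =>
      exact hT.2.2 u (mem_of_mem_listEdges he (by simp)) u
        (mem_flatten_of_mem_sysEdges hf (by simp)) rfl

variable {V : Type*}

/-- A system of disjoint paths covering all vertices, with the edges of `F`. -/
structure IsListDecomposition (F : SimpleGraph V) (T : List (List V)) : Prop where
  nodup : T.flatten.Nodup
  -- Isolated vertices occur as one-vertex lists, so that they too can receive a dummy edge.
  mem : ∀ v, v ∈ T.flatten
  edges : ∀ e, e ∈ F.edgeSet ↔ e ∈ sysEdges T

theorem IsListDecomposition.perm {F : SimpleGraph V} {T T' : List (List V)}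
    (h : IsListDecomposition F T) (hp : T.Perm T') : IsListDecomposition F T' where
  nodup := hp.flatten.nodup_iff.mp h.nodup
  mem v := hp.flatten.mem_iff.mp (h.mem v)
  edges e := (h.edges e).trans (hp.flatMap_right listEdges).mem_iff

theorem exists_perm_cons_of_mem_flatten {T : List (List V)} {v : V} (h : v ∈ T.flatten) :
    ∃ A R, T.Perm (A :: R) ∧ v ∈ A := by
  obtain ⟨A, hA, hv⟩ := List.mem_flatten.mp h
  obtain ⟨s, t, rfl⟩ := List.append_of_mem hA
  exact ⟨A, s ++ t, List.perm_middle, hv⟩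

theorem IsListDecomposition.reachable {F : SimpleGraph V} {T : List (List V)}
    (h : IsListDecomposition F T) {A : List V} (hA : A ∈ T) {x y : V} (hx : x ∈ A) (hy : y ∈ A) :
    F.Reachable x y := by
  have key : ∀ B : List V, (∀ e ∈ listEdges B, e ∈ F.edgeSet) → ∀ b ∈ B.head?, ∀ z ∈ B,
      F.Reachable b z := by
    intro B
    induction B with
    | nil => simp
    | cons a B ih => cases B with
      | nil => simp
      | cons c B =>
        rintro hB b hb z hz
        simp only [List.head?_cons, Option.mem_def, Option.some.injEq] at hb
        subst hb
        rcases List.mem_cons.mp hz with rfl | hz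
        · exact SimpleGraph.Reachable.refl _
        · have hac : F.Adj a c := hB s(a, c) (by simp)
          exact hac.reachable.trans
            (ih (fun e he => hB e (by simp [he])) c (by simp) z hz)
  have hE : ∀ e ∈ listEdges A, e ∈ F.edgeSet := fun e he =>
    (h.edges e).mpr (List.mem_flatMap.mpr ⟨A, hA, he⟩)
  cases A with
  | nil => simp at hx
  | cons a A =>
    exact (key _ hE a (by simp) x hx).symm.trans (key _ hE a (by simp) y hy)

/-- A vertex of degree at most one is an end of its path. -/
theorem IsListDecomposition.eq_nil_or_eq_nil {F : SimpleGraph V} {T : List (List V)}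
    (h : IsListDecomposition F T) {s t : List V} {x : V} (hA : s ++ x :: t ∈ T)
    (hs : (F.neighborSet x).Subsingleton) : s = [] ∨ t = [] := by
  have hE : ∀ e ∈ listEdges (s ++ x :: t), e ∈ F.edgeSet := fun e he =>
    (h.edges e).mpr (List.mem_flatMap.mpr ⟨_, hA, he⟩)
  rcases t with _ | ⟨b, t⟩
  · exact Or.inr rfl
  · rcases s.eq_nil_or_concat with rfl | ⟨s, a, rfl⟩
    · exact Or.inl rfl
    · exfalso
      rw [List.concat_eq_append] at hA hE
      have e : listEdges (s ++ [a] ++ x :: b :: t) =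
          listEdges (s ++ [a]) ++ s(a, x) :: s(x, b) :: listEdges (b :: t) := by
        rw [List.append_assoc, List.singleton_append, listEdges_append_cons]; rfl
      have h1 : F.Adj x a := (show F.Adj a x from hE s(a, x) (by rw [e]; simp)).symm
      have h2 : F.Adj x b := hE s(x, b) (by rw [e]; simp)
      have hab : a = b := hs h1 h2
      have hn : (s ++ [a] ++ x :: b :: t).Nodup :=
        (List.nodup_flatten.mp h.nodup).1 _ hA
      subst hab
      rw [List.nodup_append] at hn
      exact hn.2.2 a (by simp) a (by simp) rfl

/-- A path ending in a vertex of degree at most one can be traversed so that it comes last. -/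
theorem IsListDecomposition.exists_concat {F : SimpleGraph V} {T : List (List V)}
    (h : IsListDecomposition F T) {A : List V} (hA : A ∈ T) {x : V} (hx : x ∈ A)
    (hs : (F.neighborSet x).Subsingleton) :
    ∃ M, (M ++ [x]).Perm A ∧ (listEdges (M ++ [x])).Perm (listEdges A) := by
  obtain ⟨s, t, rfl⟩ := List.append_of_mem hx
  rcases h.eq_nil_or_eq_nil hA hs with rfl | rfl
  · refine ⟨t.reverse, ?_, ?_⟩
    · rw [List.nil_append, ← List.reverse_cons]
      exact List.reverse_perm _
    · rw [List.nil_append, ← List.reverse_cons]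
      exact listEdges_reverse _
  · exact ⟨s, List.Perm.refl _, List.Perm.refl _⟩

theorem IsListDecomposition.mem_of_reachable {F : SimpleGraph V} {T : List (List V)}
    (h : IsListDecomposition F T) {A : List V} (hA : A ∈ T) {x y : V} (hx : x ∈ A)
    (hxy : F.Reachable x y) : y ∈ A := by
  obtain ⟨w⟩ := hxy
  induction w with
  | nil => exact hx
  | @cons u v w huv _ ih =>
    refine ih ?_
    obtain ⟨B, hB, he⟩ := List.mem_flatMap.mp ((h.edges s(u, v)).mp huv)
    have huB : u ∈ B := mem_of_mem_listEdges he (by simp)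
    have hAB : A = B := by
      obtain ⟨s, t, rfl⟩ := List.append_of_mem hA
      have hn := (h.perm List.perm_middle).nodup
      rw [List.flatten_cons, List.nodup_append] at hn
      rcases List.mem_cons.mp (List.perm_middle.mem_iff.mp hB) with rfl | hB
      · rfl
      · exact absurd rfl (hn.2.2 u hx u (List.mem_flatten.mpr ⟨B, hB, huB⟩))
    rw [hAB]
    exact mem_of_mem_listEdges he (by simp)

/-- Two paths with ends `x` and `y` can be joined. -/
theorem IsListDecomposition.exists_perm_cons_cons {F : SimpleGraph V} {T : List (List V)}
    (h : IsListDecomposition F T) {x y : V} (hx : (F.neighborSet x).Subsingleton)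
    (hy : (F.neighborSet y).Subsingleton) (hxy : ¬ F.Reachable x y) :
    ∃ M N R, ((M ++ [x] ++ y :: N) :: R).flatten.Perm T.flatten ∧
      (sysEdges ((M ++ [x] ++ y :: N) :: R)).Perm (s(x, y) :: sysEdges T) := by
  obtain ⟨A, S, hA, hxA⟩ := exists_perm_cons_of_mem_flatten (h.mem x)
  have h' := h.perm hA
  have hyS : y ∈ S.flatten := by
    have := h'.mem y
    rw [List.flatten_cons, List.mem_append] at this
    exact this.resolve_left fun hyA => hxy (h'.reachable (by simp) hxA hyA)
  obtain ⟨B, R, hB, hyB⟩ := exists_perm_cons_of_mem_flatten hyS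
  have hT : T.Perm (A :: B :: R) := hA.trans (hB.cons A)
  have h'' := h.perm hT
  obtain ⟨M, hM, hM'⟩ := h''.exists_concat (by simp) hxA hx
  obtain ⟨N, hN, hN'⟩ := h''.exists_concat (by simp) hyB hy
  have hr : y :: N.reverse = (N ++ [y]).reverse := by simp
  refine ⟨M, N.reverse, R, ?_, ?_⟩
  · refine List.Perm.trans ?_ hT.flatten.symm
    rw [List.flatten_cons, List.flatten_cons, List.flatten_cons, List.append_assoc]
    refine hM.append ((List.Perm.trans ?_ hN).append_right _)
    rw [hr]
    exact List.reverse_perm _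
  · refine List.Perm.trans ?_ ((hT.flatMap_right listEdges).symm.cons s(x, y))
    rw [← sysEdges, sysEdges_cons, sysEdges_cons, sysEdges_cons, List.append_assoc M,
      List.singleton_append, listEdges_append_cons, listEdges_cons_cons, List.append_assoc,
      List.cons_append]
    refine List.perm_middle.trans (List.Perm.cons _ ?_)
    refine hM'.append ((List.Perm.trans ?_ hN').append_right _)
    rw [hr]
    exact listEdges_reverse _

theorem IsLinearForest.mono {F F' : SimpleGraph V} (h : IsLinearForest F) (hle : F' ≤ F) :
    IsLinearForest F' :=
  ⟨h.1.anti hle, fun v => (Set.encard_le_encard fun _ hw => hle hw).trans (h.2 v)⟩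

/-- A finite linear forest is a union of disjoint paths. -/
theorem IsLinearForest.exists_listDecomposition [Finite V] {F : SimpleGraph V}
    (hF : IsLinearForest F) : ∃ T, IsListDecomposition F T := by
  classical
  have := Fintype.ofFinite V
  induction hn : F.edgeSet.ncard using Nat.strong_induction_on generalizing F with
  | _ n ih =>
  rcases F.edgeSet.eq_empty_or_nonempty with h0 | ⟨e, he⟩
  · have hfl : ((Finset.univ : Finset V).toList.map fun v => [v]).flatten =
        (Finset.univ : Finset V).toList := by
      generalize (Finset.univ : Finset V).toList = l
      induction l with
      | nil => rfl
      | cons a l ih => simp [ih]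
    refine ⟨(Finset.univ : Finset V).toList.map fun v => [v], ?_, fun v => ?_, fun e => ?_⟩
    · rw [hfl]; exact Finset.nodup_toList _
    · rw [hfl]; simp
    · simp [h0, sysEdges, List.mem_flatMap]
  · induction e with
    | _ x y =>
    have hxy : F.Adj x y := he
    -- After deletion of `xy` both `x` and `y` have at most one neighbour left and, since `xy` is a
    -- bridge, lie in different components; their paths can be joined to restore the edge.
    set F' := F.deleteEdges {s(x, y)} with hF'
    have hle : F' ≤ F := F.deleteEdges_le _
    have hE : F'.edgeSet = F.edgeSet \ {s(x, y)} := F.edgeSet_deleteEdges _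
    have hsub : ∀ u v : V, F.Adj u v → s(u, v) = s(x, y) → (F'.neighborSet u).Subsingleton := by
      intro u v huv hs
      have hv : v ∉ F'.neighborSet u := by
        rw [SimpleGraph.mem_neighborSet, ← SimpleGraph.mem_edgeSet, hE]
        simp [hs]
      have h1 : insert v (F'.neighborSet u) ⊆ F.neighborSet u :=
        Set.insert_subset huv fun w hw => hle hw
      have h2 := (Set.encard_le_encard h1).trans (hF.2 u)
      rw [Set.encard_insert_of_notMem hv, show (2 : ℕ∞) = 1 + 1 by norm_num] at h2
      exact Set.encard_le_one_iff_subsingleton.mp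
        ((ENat.add_le_add_iff_right (by simp)).mp h2)
    have hnr : ¬ F'.Reachable x y := by
      have := SimpleGraph.isAcyclic_iff_forall_adj_isBridge.mp hF.1 hxy
      rwa [SimpleGraph.isBridge_iff] at this
    obtain ⟨T, hT⟩ := ih F'.edgeSet.ncard (by
      rw [← hn, hE]
      exact Set.ncard_sdiff_singleton_lt_of_mem he (Set.toFinite _)) (hF.mono hle) rfl
    obtain ⟨M, N, R, h1, h2⟩ := hT.exists_perm_cons_cons (hsub x y hxy rfl)
      (hsub y x hxy.symm Sym2.eq_swap) hnr
    refine ⟨_, h1.nodup_iff.mpr hT.nodup, fun v => h1.mem_iff.mpr (hT.mem v), fun e => ?_⟩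
    rw [h2.mem_iff, List.mem_cons, ← hT.edges, hE]
    by_cases h : e = s(x, y)
    · subst h; simp [hxy]
    · simp [h]

/-- A component of a linear forest has at most two vertices of degree at most one. -/
theorem IsLinearForest.not_reachable [Finite V] {F : SimpleGraph V} (hF : IsLinearForest F)
    {x y z : V} (hx : (F.neighborSet x).Subsingleton) (hy : (F.neighborSet y).Subsingleton)
    (hz : (F.neighborSet z).Subsingleton) (hxy : x ≠ y) (hxz : x ≠ z) (hyz : y ≠ z) :
    ¬ (F.Reachable x y ∧ F.Reachable x z) := by
  rintro ⟨h1, h2⟩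
  obtain ⟨T, hT⟩ := hF.exists_listDecomposition
  obtain ⟨A, hA, hxA⟩ := List.mem_flatten.mp (hT.mem x)
  -- A vertex of degree at most one is first or last in its list, and three vertices do not fit into
  -- two places.
  have key : ∀ u ∈ A, (F.neighborSet u).Subsingleton → A.head? = some u ∨ A.getLast? = some u := by
    intro u hu hs
    obtain ⟨s, t, rfl⟩ := List.append_of_mem hu
    rcases hT.eq_nil_or_eq_nil hA hs with rfl | rfl
    · exact Or.inl rfl
    · exact Or.inr (by simp)
  have k1 := key x hxA hx
  have k2 := key y (hT.mem_of_reachable hA hxA h1) hy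
  have k3 := key z (hT.mem_of_reachable hA hxA h2) hz
  have hne : ∀ {o : Option V} {u v : V}, u ≠ v → o = some u → o ≠ some v := by
    rintro o u v h rfl h'
    exact h (Option.some.inj h')
  rcases k1 with k1 | k1
  · exact hne hyz (k2.resolve_left (hne hxy k1)) (k3.resolve_left (hne hxz k1))
  · exact hne hyz (k2.resolve_right (hne hxy k1)) (k3.resolve_right (hne hxz k1))

theorem IsListDecomposition.sysChain_eq [Finite V] {F : SimpleGraph V} {T : List (List V)}
    (h : IsListDecomposition F T) : sysChain T = graphChain F := by
  classical
  ext e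
  rw [sysChain_eq_sum, sum_map_single_apply (nodup_sysEdges h.nodup), graphChain_apply]
  simp only [h.edges]

/-- Removing isolated vertices yields a path system. -/
theorem exists_isPathSystem {W : Type*} (T : List (List W)) (hT : T.flatten.Nodup) :
    ∃ L, IsPathSystem L ∧ sysChain L = sysChain T ∧ ∀ e ∈ sysEdges T, e ∈ sysEdges L := by
  have hs : ∀ A : List W, ¬ 2 ≤ A.length → listEdges A = [] ∧ listChain A = 0 := by
    rintro (_ | ⟨a, _ | ⟨b, A⟩⟩) h
    · simp
    · simp
    · simp at h
  refine ⟨T.filter fun A => 2 ≤ A.length, ⟨?_, fun A hA => ?_⟩, ?_, fun e he => ?_⟩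
  · exact hT.sublist (List.filter_sublist.flatten)
  · simpa using (List.mem_filter.mp hA).2
  · induction T with
    | nil => rfl
    | cons A T ih =>
      have ih := ih (by
        rw [List.flatten_cons] at hT
        exact (List.nodup_append.mp hT).2.1)
      rw [List.filter_cons]
      split_ifs with h
      · rw [sysChain_cons, sysChain_cons, ih]
      · rw [sysChain_cons, ih, (hs A (by simpa using h)).2, zero_add]
  · obtain ⟨A, hA, he⟩ := List.mem_flatMap.mp he
    refine List.mem_flatMap.mpr ⟨A, List.mem_filter.mpr ⟨hA, ?_⟩, he⟩
    by_contra h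
    rw [(hs A (by simpa using h)).1] at he
    simp at he

theorem sysChain_map {V W : Type*} (f : V → W) (T : List (List V)) :
    sysChain (T.map (List.map f)) = Finsupp.mapDomain (Sym2.map f) (sysChain T) := by
  induction T with
  | nil => simp
  | cons A T ih => simp [ih, listChain_map, Finsupp.mapDomain_add]

theorem IsLinearForest.exists_pathSystem [Finite V] {F : SimpleGraph V} (hF : IsLinearForest F) :
    ∃ L : List (List (V ⊕ ℕ)), IsPathSystem L ∧ sysChain L = graphChainSum F := by
  obtain ⟨T, hT⟩ := hF.exists_listDecomposition
  obtain ⟨L, h1, h2, -⟩ := exists_isPathSystem (T.map (List.map (Sum.inl : V → V ⊕ ℕ)))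
    (by rw [← List.map_flatten]; exact hT.nodup.map Sum.inl_injective)
  exact ⟨L, h1, by rw [h2, sysChain_map, hT.sysChain_eq, graphChainSum]⟩

/-- A dummy edge can be added between two vertices of degree at most one in different
components. -/
theorem IsLinearForest.exists_pathSystem_edge [Finite V] {F : SimpleGraph V}
    (hF : IsLinearForest F) {x y : V} (hx : (F.neighborSet x).Subsingleton)
    (hy : (F.neighborSet y).Subsingleton) (hxy : ¬ F.Reachable x y) :
    ∃ L : List (List (V ⊕ ℕ)), IsPathSystem L ∧
      sysChain L = graphChainSum F + edgeChain (Sum.inl x) (Sum.inl y) ∧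
      s(Sum.inl x, Sum.inl y) ∈ sysEdges L := by
  obtain ⟨T, hT⟩ := hF.exists_listDecomposition
  obtain ⟨M, N, R, h1, h2⟩ := hT.exists_perm_cons_cons hx hy hxy
  set S := (M ++ [x] ++ y :: N) :: R
  obtain ⟨L, g1, g2, g3⟩ := exists_isPathSystem (S.map (List.map (Sum.inl : V → V ⊕ ℕ)))
    (by
      rw [← List.map_flatten]
      exact (h1.nodup_iff.mpr hT.nodup).map Sum.inl_injective)
  refine ⟨L, g1, ?_, g3 _ ?_⟩
  · rw [g2, sysChain_map, sysChain_eq_sum, (h2.map _).sum_eq, List.map_cons, List.sum_cons,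
      ← sysChain_eq_sum, hT.sysChain_eq, Finsupp.mapDomain_add, Finsupp.mapDomain_single,
      graphChainSum, add_comm]
    rfl
  · have : s(x, y) ∈ sysEdges S := h2.mem_iff.mpr (by simp)
    obtain ⟨A, hA, he⟩ := List.mem_flatMap.mp this
    refine List.mem_flatMap.mpr ⟨_, List.mem_map_of_mem hA, ?_⟩
    rw [listEdges_map]
    exact List.mem_map_of_mem (f := Sym2.map Sum.inl) he

/-- A dummy edge can be added between a vertex of degree at most one and a new vertex. -/
theorem IsLinearForest.exists_pathSystem_new [Finite V] {F : SimpleGraph V}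
    (hF : IsLinearForest F) {x : V} (hx : (F.neighborSet x).Subsingleton) :
    ∃ L : List (List (V ⊕ ℕ)), IsPathSystem L ∧
      sysChain L = graphChainSum F + edgeChain (Sum.inl x) (Sum.inr 0) ∧
      s(Sum.inl x, Sum.inr 0) ∈ sysEdges L := by
  obtain ⟨T, hT⟩ := hF.exists_listDecomposition
  obtain ⟨A, R, hA, hxA⟩ := exists_perm_cons_of_mem_flatten (hT.mem x)
  have hT' := hT.perm hA
  obtain ⟨M, hM, hM'⟩ := hT'.exists_concat (by simp) hxA hx
  let f : V → V ⊕ ℕ := Sum.inl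
  have hn : (((M ++ [x]) :: R).map (List.map f)).flatten.Nodup := by
    rw [← List.map_flatten]
    refine List.Nodup.map Sum.inl_injective ?_
    rw [List.flatten_cons, (hM.append_right _).nodup_iff]
    exact hT'.nodup
  have hc : sysChain ((M ++ [x]) :: R) = graphChain F := by
    rw [← hT'.sysChain_eq, sysChain_cons, sysChain_cons, listChain_eq_sum, (hM'.map _).sum_eq,
      ← listChain_eq_sum]
  obtain ⟨L, g1, g2, g3⟩ := exists_isPathSystem
    ((M.map f ++ [f x, Sum.inr 0]) :: R.map (List.map f)) (by
      have : ((M.map f ++ [f x, Sum.inr 0]) :: R.map (List.map f)).flatten.Perm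
          (Sum.inr 0 :: (((M ++ [x]) :: R).map (List.map f)).flatten) := by
        rw [List.map_cons, List.flatten_cons, List.flatten_cons, List.map_append,
          show M.map f ++ [f x, Sum.inr 0] = M.map f ++ [f x] ++ [Sum.inr 0] by simp,
          List.append_assoc (M.map f ++ [f x])]
        exact List.perm_middle
      rw [this.nodup_iff, List.nodup_cons]
      refine ⟨?_, hn⟩
      rw [← List.map_flatten, List.mem_map]
      rintro ⟨v, -, hv⟩
      exact Sum.inl_ne_inr hv)
  refine ⟨L, g1, ?_, g3 _ ?_⟩
  · rw [g2, sysChain_cons, listChain_concat, graphChainSum, ← hc, ← sysChain_map, List.map_cons,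
      sysChain_cons, List.map_append]
    simp only [List.map_cons, List.map_nil]
    abel
  · rw [sysEdges_cons, listEdges_append_cons]
    simp [f]

end LinearForests

/-! ### Splitting cycles into a linear forest and a matching. -/

section Splitting

variable {U V : Type*}

/-- A union of cycles and paths that splits into two linear forests with little freedom lost at any
four prescribed vertices: `F'` is a matching, and `F` has degree at most one at all of the
prescribed vertices but one. -/
def Splittable (C : SimpleGraph V) : Prop :=
  ∀ S : Finset V, S.card ≤ 4 → ∃ F F' : SimpleGraph V, IsLinearForest F ∧
    (∀ v, (F'.neighborSet v).Subsingleton) ∧ (∀ v w, F.Adj v w → ¬ F'.Adj v w) ∧ C = F ⊔ F' ∧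
    (∀ v, ¬ (F.neighborSet v).Subsingleton → F'.neighborSet v = ∅) ∧
    ∀ v ∈ S, ∀ w ∈ S, ¬ (F.neighborSet v).Subsingleton → ¬ (F.neighborSet w).Subsingleton → v = w

theorem IsLinearForest.comap {F : SimpleGraph U} (h : IsLinearForest F) (f : V ↪ U) :
    IsLinearForest (F.comap f) := by
  refine ⟨h.1.comap (SimpleGraph.Embedding.comap f F).toHom f.injective, fun v => ?_⟩
  refine le_trans ?_ (h.2 (f v))
  rw [← f.injective.encard_image]
  exact Set.encard_le_encard (Set.image_subset_iff.mpr fun w hw => hw)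

/-- Degrees only drop in an induced subgraph. This serves to return from a doubled graph to one of
its two copies. -/
theorem Splittable.comap {C : SimpleGraph U} (h : Splittable C) (f : V ↪ U) :
    Splittable (C.comap f) := by
  intro S hS
  obtain ⟨F, F', h1, h2, h3, h4, h5, h6⟩ := h (S.map f) (by rwa [Finset.card_map])
  have hsub : ∀ v, ¬ ((F.comap f).neighborSet v).Subsingleton →
      ¬ (F.neighborSet (f v)).Subsingleton := fun v hv hF =>
    hv fun a ha b hb => f.injective (hF ha hb)
  refine ⟨F.comap f, F'.comap f, h1.comap f, fun v a ha b hb => f.injective (h2 _ ha hb),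
    fun v w => h3 _ _, by rw [h4]; rfl, fun v hv => ?_, fun v hv w hw hv' hw' =>
    f.injective (h6 _ (Finset.mem_map_of_mem f hv) _ (Finset.mem_map_of_mem f hw)
      (hsub v hv') (hsub w hw'))⟩
  have := h5 _ (hsub v hv)
  ext w
  exact ⟨fun hw => this.subset (show f w ∈ F'.neighborSet (f v) from hw), fun hw => hw.elim⟩

/-- Every vertex of a cycle has two neighbours, so the first edge of a cycle would join two vertices
of the excluded kind. -/
theorem isAcyclic_of_not_adj (F : SimpleGraph V)
    (h : ∀ v w, F.Adj v w → ¬ (F.neighborSet v).Subsingleton →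
      ¬ (F.neighborSet w).Subsingleton → False) : F.IsAcyclic := by
  classical
  have key : ∀ (v : V) (c : F.Walk v v), c.IsCycle → ¬ (F.neighborSet v).Subsingleton :=
    fun v c hc hs => hc.snd_ne_penultimate (hs (c.adj_snd hc.not_nil)
      (c.adj_penultimate hc.not_nil).symm)
  intro v c hc
  have hmem : c.snd ∈ c.support := c.getVert_mem_support 1
  exact h v c.snd (c.adj_snd hc.not_nil) (key v c hc) (key _ _ (hc.rotate hmem))

/-- The undirected graph of the nontrivial cycles of a permutation. -/
def permGraph (σ : Equiv.Perm V) : SimpleGraph V where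
  Adj v w := v ≠ w ∧ (σ v = w ∨ σ w = v)
  symm := ⟨fun _ _ h => ⟨h.1.symm, h.2.symm⟩⟩
  loopless := ⟨fun _ h => h.1 rfl⟩

/-- The points of a permutation can be coloured alternatingly along each cycle, except at one
representative of the cycle, which avoids a given set if possible. -/
theorem exists_alternating [Finite V] (σ : Equiv.Perm V) (S : Set V) :
    ∃ (c : V → Prop) (ρ : V → V), (∀ v w, σ.SameCycle v w → ρ v = ρ w) ∧
      (∀ v, ρ v ∈ S → ∀ w, σ.SameCycle v w → w ∈ S) ∧
      (∀ v, c v → ¬ c (σ v)) ∧ ∀ v, ¬ c v → ¬ c (σ v) → ρ v = σ v := by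
  classical
  have := Fintype.ofFinite V
  let s := Equiv.Perm.SameCycle.setoid σ
  have hr : ∀ q : Quotient s, ∃ u, Quotient.mk s u = q ∧
      (u ∈ S → ∀ w, Quotient.mk s w = q → w ∈ S) := by
    intro q
    by_cases h : ∃ u, Quotient.mk s u = q ∧ u ∉ S
    · obtain ⟨u, hu, huS⟩ := h
      exact ⟨u, hu, fun h => absurd h huS⟩
    · push Not at h
      obtain ⟨u, hu⟩ := Quotient.exists_rep q
      exact ⟨u, hu, fun _ => h⟩
  choose r hr1 hr2 using hr
  let ρ : V → V := fun v => r (Quotient.mk s v)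
  have hρ : ∀ v w, σ.SameCycle v w → ρ v = ρ w := fun v w h =>
    congrArg r (Quotient.sound h)
  have hρs : ∀ v, σ.SameCycle (ρ v) v := fun v => Quotient.exact (hr1 (Quotient.mk s v))
  have hk : ∀ v, ∃ k : ℕ, (σ ^ k) (ρ v) = v := fun v => by
    obtain ⟨k, -, hk⟩ := (hρs v).exists_pow_eq'
    exact ⟨k, hk⟩
  have hσ : ∀ v, ρ (σ v) = ρ v := fun v =>
    hρ _ _ (Equiv.Perm.sameCycle_apply_left.mpr (Equiv.Perm.SameCycle.refl _ _))
  -- `Nat.find (hk v)` is the position of `v` on its cycle, counted from the representative.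
  have hstep : ∀ v, σ v ≠ ρ v → Nat.find (hk (σ v)) = Nat.find (hk v) + 1 := by
    intro v hv
    have h1 := Nat.find_spec (hk v)
    have h2 := Nat.find_spec (hk (σ v))
    apply le_antisymm
    · refine Nat.find_min' _ ?_
      rw [hσ, pow_succ', Equiv.Perm.mul_apply, h1]
    · rcases hm : Nat.find (hk (σ v)) with _ | m
      · rw [hm, hσ] at h2
        exact absurd h2.symm hv
      · refine Nat.succ_le_succ (Nat.find_min' _ ?_)
        rw [hm, hσ, pow_succ', Equiv.Perm.mul_apply] at h2
        exact σ.injective h2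
  have hzero : ∀ v, σ v = ρ v → Nat.find (hk (σ v)) = 0 := by
    intro v hv
    rw [Nat.find_eq_zero, hσ, ← hv]
    rfl
  -- The colour is the parity of the position. Two consecutive even positions occur only where an
  -- odd cycle returns to its representative, at position zero.
  refine ⟨fun v => Odd (Nat.find (hk v)), ρ, hρ, fun v hv w hw => ?_, fun v hv => ?_,
    fun v hv hv' => ?_⟩
  · exact hr2 _ hv w (Quotient.sound hw.symm)
  · by_cases h : σ v = ρ v
    · beta_reduce
      rw [hzero v h]
      decide
    · beta_reduce
      rw [hstep v h, Nat.not_odd_iff_even]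
      exact Odd.add_one hv
  · by_contra h
    beta_reduce at hv hv'
    rw [hstep v (Ne.symm h), Nat.not_odd_iff_even] at hv'
    rw [Nat.not_odd_iff_even] at hv
    exact Nat.not_even_iff_odd.mpr hv.add_one hv'

/-- The edges of a cycle alternate between `F` and `F'`, except that both edges at the
representative of an odd cycle go to `F`. So only representatives can have degree two in `F`. A
representative lies in `S` only if its whole cycle does, and since nontrivial cycles have at least
three vertices, at most one of them fits into four vertices. -/
theorem splittable_permGraph [Finite V] (σ : Equiv.Perm V) (hσ : ∀ v, σ v ≠ v → σ (σ v) ≠ v) :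
    Splittable (permGraph σ) := by
  classical
  intro S hS
  obtain ⟨c, ρ, h1, h2, h3, h4⟩ := exists_alternating σ (S : Set V)
  let F : SimpleGraph V :=
    { Adj := fun v w => v ≠ w ∧ (σ v = w ∧ ¬ c v ∨ σ w = v ∧ ¬ c w)
      symm := ⟨fun _ _ h => ⟨h.1.symm, h.2.symm⟩⟩
      loopless := ⟨fun _ h => h.1 rfl⟩ }
  let F' : SimpleGraph V :=
    { Adj := fun v w => v ≠ w ∧ (σ v = w ∧ c v ∨ σ w = v ∧ c w)
      symm := ⟨fun _ _ h => ⟨h.1.symm, h.2.symm⟩⟩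
      loopless := ⟨fun _ h => h.1 rfl⟩ }
  have hint : ∀ v, ¬ (F.neighborSet v).Subsingleton →
      σ v ≠ v ∧ ¬ c v ∧ ∃ u, σ u = v ∧ ¬ c u := by
    intro v hv
    rw [Set.not_subsingleton_iff] at hv
    obtain ⟨a, ⟨ha0, ha⟩, b, ⟨hb0, hb⟩, hab⟩ := hv
    rcases ha with ⟨ha, hac⟩ | ⟨ha, hac⟩ <;> rcases hb with ⟨hb, hbc⟩ | ⟨hb, hbc⟩
    · exact absurd (ha.symm.trans hb) hab
    · exact ⟨fun h => ha0 (h.symm.trans ha), hac, b, hb, hbc⟩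
    · exact ⟨fun h => hb0 (h.symm.trans hb), hbc, a, ha, hac⟩
    · exact absurd (σ.injective (ha.trans hb.symm)) hab
  have hrep : ∀ v, ¬ (F.neighborSet v).Subsingleton → ρ v = v := by
    intro v hv
    obtain ⟨-, hc, u, rfl, hu⟩ := hint v hv
    exact (h1 (σ u) u (Equiv.Perm.sameCycle_apply_left.mpr
      (Equiv.Perm.SameCycle.refl _ _))).trans (h4 u hu hc)
  have hsc : ∀ v w, F.Adj v w → σ.SameCycle v w := by
    rintro v w ⟨-, ⟨rfl, -⟩ | ⟨rfl, -⟩⟩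
    · exact Equiv.Perm.sameCycle_apply_right.mpr (Equiv.Perm.SameCycle.refl _ _)
    · exact Equiv.Perm.sameCycle_apply_left.mpr (Equiv.Perm.SameCycle.refl _ _)
  refine ⟨F, F', ⟨isAcyclic_of_not_adj F fun v w hvw hv hw => ?_, fun v => ?_⟩, fun v => ?_,
    fun v w => ?_, ?_, fun v hv => ?_, fun v hv w hw hv' hw' => ?_⟩
  · exact hvw.ne ((hrep v hv).symm.trans ((h1 v w (hsc v w hvw)).trans (hrep w hw)))
  · have : F.neighborSet v ⊆ {σ v, σ.symm v} := by
      rintro w ⟨-, ⟨h, -⟩ | ⟨h, -⟩⟩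
      · exact Or.inl h.symm
      · exact Or.inr (by rw [← h]; simp)
    exact (Set.encard_le_encard this).trans ((Set.encard_insert_le _ _).trans
      (by rw [Set.encard_singleton]; norm_num))
  · rintro a ⟨-, ha⟩ b ⟨-, hb⟩
    rcases ha with ⟨ha, hac⟩ | ⟨ha, hac⟩ <;> rcases hb with ⟨hb, hbc⟩ | ⟨hb, hbc⟩
    · exact ha.symm.trans hb
    · exact absurd hac (hb ▸ h3 b hbc)
    · exact absurd hbc (ha ▸ h3 a hac)
    · exact σ.injective (ha.trans hb.symm)
  -- Without cycles of length two, an edge arises from only one of its ends and gets only one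
  -- colour.
  · rintro ⟨hne, h⟩ ⟨-, h'⟩
    rcases h with ⟨ha, hac⟩ | ⟨ha, hac⟩ <;> rcases h' with ⟨hb, hbc⟩ | ⟨hb, hbc⟩
    · exact hac hbc
    · exact hσ v (by rw [ha]; exact hne.symm) (by rw [ha, hb])
    · exact hσ v (by rw [hb]; exact hne.symm) (by rw [hb, ha])
    · exact hac hbc
  · ext v w
    change (v ≠ w ∧ (σ v = w ∨ σ w = v)) ↔ (v ≠ w ∧ (σ v = w ∧ ¬ c v ∨ σ w = v ∧ ¬ c w)) ∨
      (v ≠ w ∧ (σ v = w ∧ c v ∨ σ w = v ∧ c w))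
    tauto
  · obtain ⟨-, hc, u, hu, huc⟩ := hint v hv
    refine Set.eq_empty_iff_forall_notMem.mpr ?_
    rintro w ⟨-, ⟨-, h⟩ | ⟨h, hw⟩⟩
    · exact hc h
    · exact huc (σ.injective (h.trans hu.symm) ▸ hw)
  · by_contra hvw
    have hsub : ∀ v ∈ S, ¬ (F.neighborSet v).Subsingleton →
        σ v ∈ S ∧ σ (σ v) ∈ S ∧ σ v ≠ v := by
      intro v hv hv'
      have := h2 v (by rw [hrep v hv']; exact hv)
      refine ⟨this _ ?_, this _ ?_, (hint v hv').1⟩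
      · exact Equiv.Perm.sameCycle_apply_right.mpr (Equiv.Perm.SameCycle.refl _ _)
      · exact Equiv.Perm.sameCycle_apply_right.mpr
          (Equiv.Perm.sameCycle_apply_right.mpr (Equiv.Perm.SameCycle.refl _ _))
    obtain ⟨a1, a2, a3⟩ := hsub v hv hv'
    obtain ⟨b1, b2, b3⟩ := hsub w hw hw'
    have hns : ¬ σ.SameCycle v w := fun h =>
      hvw ((hrep v hv').symm.trans ((h1 v w h).trans (hrep w hw')))
    have hd : ∀ a b, σ.SameCycle v a → σ.SameCycle w b → a ≠ b := by
      rintro a b ha hb rfl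
      exact hns (ha.trans hb.symm)
    have s1 : ∀ v, σ.SameCycle v (σ v) := fun v =>
      Equiv.Perm.sameCycle_apply_right.mpr (Equiv.Perm.SameCycle.refl _ _)
    have s0 : ∀ v, σ.SameCycle v v := fun v => Equiv.Perm.SameCycle.refl _ _
    have s2 : ∀ v, σ.SameCycle v (σ (σ v)) := fun v => (s1 v).trans (s1 _)
    have hn : [v, σ v, σ (σ v), w, σ w, σ (σ w)].Nodup := by
      simp [a3.symm, b3.symm, (hσ v a3).symm, (hσ w b3).symm, hd v w (s0 v) (s0 w),
        hd v (σ w) (s0 v) (s1 w), hd v (σ (σ w)) (s0 v) (s2 w), hd (σ v) w (s1 v) (s0 w),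
        hd (σ v) (σ (σ w)) (s1 v) (s2 w), hd (σ (σ v)) w (s2 v) (s0 w),
        hd (σ v) (σ w) (s1 v) (s1 w), hd (σ (σ v)) (σ w) (s2 v) (s1 w),
        hd (σ (σ v)) (σ (σ w)) (s2 v) (s2 w)]
    have hcard := List.toFinset_card_of_nodup hn
    have hle : [v, σ v, σ (σ v), w, σ w, σ (σ w)].toFinset ⊆ S := by
      intro x hx
      simp only [List.mem_toFinset, List.mem_cons, List.not_mem_nil, or_false] at hx
      rcases hx with rfl | rfl | rfl | rfl | rfl | rfl <;> assumption
    have := Finset.card_le_card hle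
    rw [hcard] at this
    simp at this
    omega

end Splitting

/-! ### A version of Petersen's 2-factor theorem. -/

section Petersen

variable {U V : Type*}

/-- A graph with all degrees even has an orientation with equal in- and out-degrees. -/
theorem exists_balanced_orientation [Fintype U] [DecidableEq U] (H : SimpleGraph U)
    [DecidableRel H.Adj] (heven : ∀ v, Even (H.degree v)) :
    ∃ A : U → U → Prop, (∀ v w, A v w → H.Adj v w) ∧ (∀ v w, A v w → ¬ A w v) ∧
      (∀ v, 2 * {w | A v w}.ncard = H.degree v) ∧ ∀ v, 2 * {w | A w v}.ncard = H.degree v := by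
  classical
  -- Each vertex offers half its degree many slots, and each edge chooses a slot at one of its ends,
  -- its tail. Hall's theorem makes the choices distinct.
  let t : H.edgeSet → Finset (Σ _ : U, ℕ) := fun e =>
    (Finset.univ.filter (· ∈ e.1)).sigma fun v => Finset.range (H.degree v / 2)
  have h2 : ∀ v, 2 * (H.degree v / 2) = H.degree v := fun v =>
    Nat.mul_div_cancel' (heven v).two_dvd
  have hdeg : ∀ v, (Finset.univ.filter fun e : H.edgeSet => v ∈ e.1).card = H.degree v := by
    intro v
    rw [← H.card_incidenceFinset_eq_degree, H.incidenceFinset_eq_filter]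
    refine Finset.card_bij (fun e _ => e.1) (fun e he => ?_) (fun a _ b _ h => Subtype.ext h)
      fun e he => ?_
    · simpa using (Finset.mem_filter.mp he).2
    · rw [Finset.mem_filter, SimpleGraph.mem_edgeFinset] at he
      exact ⟨⟨e, he.1⟩, by simpa using he.2, rfl⟩
  have htwo : ∀ e : H.edgeSet, (Finset.univ.filter (· ∈ e.1)).card = 2 := by
    intro e
    rw [← Sym2.card_toFinset_of_not_isDiag e.1 (H.not_isDiag_of_mem_edgeSet e.2)]
    congr 1
    ext v
    simp
  have hdc : ∀ s : Finset H.edgeSet,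
      ∑ v, (s.filter fun e => v ∈ e.1).card = 2 * s.card := by
    intro s
    have := Finset.sum_card_bipartiteAbove_eq_sum_card_bipartiteBelow
      (s := (Finset.univ : Finset U)) (t := s) (fun v e => v ∈ e.1)
    simp only [Finset.bipartiteAbove, Finset.bipartiteBelow] at this
    rw [this, Finset.sum_congr rfl fun e _ => htwo e]
    simp [mul_comm]
  obtain ⟨f, hf, hft⟩ := (Finset.all_card_le_biUnion_card_iff_exists_injective t).mp (by
    intro s
    have hu : s.biUnion t = (Finset.univ.filter fun v => ∃ e ∈ s, v ∈ e.1).sigma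
        fun v => Finset.range (H.degree v / 2) := by
      ext ⟨v, k⟩
      simp only [t, Finset.mem_biUnion, Finset.mem_sigma, Finset.mem_filter, Finset.mem_univ,
        true_and]
      exact ⟨fun ⟨e, h1, h2, h3⟩ => ⟨⟨e, h1, h2⟩, h3⟩, fun ⟨⟨e, h1, h2⟩, h3⟩ => ⟨e, h1, h2, h3⟩⟩
    rw [hu, Finset.card_sigma]
    simp only [Finset.card_range]
    -- Hall's condition by double counting: `2|s|` is at most the degree sum of the vertices met by
    -- `s`, which is twice the number of their slots.
    have h3 : ∑ v, (s.filter fun e => v ∈ e.1).card ≤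
        ∑ v ∈ Finset.univ.filter (fun v => ∃ e ∈ s, v ∈ e.1), H.degree v := by
      rw [Finset.sum_filter]
      refine Finset.sum_le_sum fun v _ => ?_
      split_ifs with h
      · rw [← hdeg]
        exact Finset.card_le_card (Finset.filter_subset_filter _ (Finset.subset_univ s))
      · rw [Finset.filter_false_of_mem fun e he hv => h ⟨e, he, hv⟩]
        simp
    rw [hdc, ← Finset.sum_congr rfl fun v _ => h2 v, ← Finset.mul_sum] at h3
    omega)
  let tail : H.edgeSet → U := fun e => (f e).1
  have htail : ∀ e, tail e ∈ e.1 := fun e => by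
    have := hft e
    simp only [t, Finset.mem_sigma, Finset.mem_filter, Finset.mem_univ, true_and] at this
    exact this.1
  have hle : ∀ v ∈ (Finset.univ : Finset U),
      (Finset.univ.filter fun e => tail e = v).card ≤ H.degree v / 2 := by
    intro v _
    rw [← Finset.card_range (H.degree v / 2)]
    refine Finset.card_le_card_of_injOn (fun e => (f e).2) (fun e he => ?_)
      (fun a ha b hb hab => ?_)
    · have h1 := hft e
      simp only [t, Finset.mem_sigma] at h1
      have h3 : (f e).1 = v := by simpa using he
      rw [h3] at h1
      exact h1.2
    · have ha' : (f a).1 = v := by simpa using ha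
      have hb' : (f b).1 = v := by simpa using hb
      exact hf (Sigma.ext (ha'.trans hb'.symm) (heq_of_eq hab))
  -- There are as many slots as edges, so every slot is used and each out-degree is exactly half the
  -- degree.
  have hsum : ∑ v, (Finset.univ.filter fun e => tail e = v).card = ∑ v, H.degree v / 2 := by
    have h3 := hdc Finset.univ
    rw [Finset.sum_congr rfl fun v _ => (hdeg v).trans (h2 v).symm, ← Finset.mul_sum] at h3
    have h4 := Finset.card_eq_sum_card_fiberwise (f := tail) (s := Finset.univ)
      (t := Finset.univ) (fun _ _ => by simp)
    omega
  have hout := (Finset.sum_eq_sum_iff_of_le hle).mp hsum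
  have hnb : ∀ (v : U) (P : H.edgeSet → Prop) [DecidablePred P], (∀ e, P e → v ∈ e.1) →
      {w | ∃ h : H.Adj v w, P ⟨s(v, w), h⟩}.ncard =
        (Finset.univ.filter fun e => P e).card := by
    intro v P _ hP
    have e1 : ((Finset.univ.filter fun e => P e : Finset H.edgeSet) : Set H.edgeSet).ncard =
        (Finset.univ.filter fun e => P e).card := Set.ncard_coe_finset _
    rw [← e1]
    refine Set.ncard_congr (fun w hw => ⟨s(v, w), hw.1⟩) (fun w hw => ?_) (fun a b _ _ h => ?_)
      (fun e he => ?_)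
    · obtain ⟨h, hw⟩ := hw
      simpa using hw
    · exact Sym2.congr_right.mp (congrArg Subtype.val h)
    · have he' : P e := by simpa using he
      obtain ⟨w, hw⟩ := hP e he'
      have hvw : H.Adj v w := by rw [← SimpleGraph.mem_edgeSet, ← hw]; exact e.2
      have : (⟨s(v, w), hvw⟩ : H.edgeSet) = e := Subtype.ext hw.symm
      exact ⟨w, ⟨hvw, by rw [this]; exact he'⟩, this⟩
  refine ⟨fun v w => ∃ h : H.Adj v w, tail ⟨s(v, w), h⟩ = v, fun v w h => h.1, ?_, fun v => ?_,
    fun v => ?_⟩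
  · rintro v w ⟨h, hv⟩ ⟨h', hw⟩
    have : (⟨s(w, v), h'⟩ : H.edgeSet) = ⟨s(v, w), h⟩ := Subtype.ext Sym2.eq_swap
    rw [this, hv] at hw
    exact h.ne hw
  · rw [hnb v (fun e => tail e = v) (by rintro e rfl; exact htail e), hout v (Finset.mem_univ v), h2]
  · have hset : {w | ∃ h : H.Adj w v, tail ⟨s(w, v), h⟩ = w} =
        {w | ∃ h : H.Adj v w, v ∈ (⟨s(v, w), h⟩ : H.edgeSet).1 ∧ tail ⟨s(v, w), h⟩ ≠ v} := by
      ext w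
      constructor
      · rintro ⟨h, hw⟩
        have : (⟨s(w, v), h⟩ : H.edgeSet) = ⟨s(v, w), h.symm⟩ := Subtype.ext Sym2.eq_swap
        rw [this] at hw
        exact ⟨h.symm, by simp, by rw [hw]; exact h.ne⟩
      · rintro ⟨h, -, hw⟩
        have : (⟨s(w, v), h.symm⟩ : H.edgeSet) = ⟨s(v, w), h⟩ := Subtype.ext Sym2.eq_swap
        refine ⟨h.symm, ?_⟩
        rw [this]
        exact (Sym2.mem_iff.mp (htail ⟨s(v, w), h⟩)).resolve_left hw
    rw [hset, hnb v (fun e => v ∈ e.1 ∧ tail e ≠ v) (fun e he => he.1)]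
    have h3 := Finset.card_filter_add_card_filter_not
      (s := Finset.univ.filter fun e : H.edgeSet => v ∈ e.1) (fun e => tail e = v)
    rw [hdeg, Finset.filter_filter, Finset.filter_filter] at h3
    have h4 : (Finset.univ.filter fun e : H.edgeSet => v ∈ e.1 ∧ tail e = v) =
        Finset.univ.filter fun e => tail e = v := by
      ext e
      simp only [Finset.mem_filter, Finset.mem_univ, true_and, and_iff_right_iff_imp]
      rintro rfl
      exact htail e
    have h5 := hout v (Finset.mem_univ v)
    rw [h4, h5] at h3
    have h6 := h2 v
    refine (congrArg (2 * ·) (a₂ := H.degree v / 2) ?_).trans h6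
    refine Nat.add_left_cancel (n := H.degree v / 2) (Eq.trans ?_ (h3.trans (by omega)))
    congr!

/-- A balanced orientation with out-degrees at most `r` contains cycles and fixed points covering
every vertex once, with the vertices of out-degree `r` not fixed. -/
theorem exists_perm_of_balanced [Fintype U] [DecidableEq U] (A : U → U → Prop) (r : ℕ)
    (hr : 0 < r) (hle : ∀ v, {w | A v w}.ncard ≤ r)
    (hin : ∀ v, {w | A w v}.ncard = {w | A v w}.ncard) :
    ∃ σ : Equiv.Perm U, ∀ v, A v (σ v) ∨ σ v = v ∧ {w | A v w}.ncard < r := by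
  classical
  -- Loops weighted with the missing out-degree bring every row and column sum to `r`. Division by
  -- `r` gives a doubly stochastic matrix, and by Birkhoff's theorem its support contains a
  -- permutation.
  let M : Matrix U U ℚ := fun v w =>
    ((if A v w then 1 else 0) + if v = w then (r - {w | A v w}.ncard : ℚ) else 0) / r
  have hr' : (r : ℚ) ≠ 0 := by positivity
  have hM : M ∈ doublyStochastic ℚ U := by
    rw [mem_doublyStochastic_iff_sum]
    refine ⟨fun v w => ?_, fun v => ?_, fun v => ?_⟩
    · have h1 : (0 : ℚ) ≤ r - {w | A v w}.ncard := by
        rw [sub_nonneg]; exact_mod_cast hle v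
      have h2 : (0 : ℚ) ≤ if v = w then (r - {w | A v w}.ncard : ℚ) else 0 := by
        split_ifs <;> simp [h1]
      have h3 : (0 : ℚ) ≤ if A v w then 1 else 0 := by split_ifs <;> simp
      exact div_nonneg (add_nonneg h3 h2) (by positivity)
    · rw [← Finset.sum_div, Finset.sum_add_distrib, Finset.sum_boole,
        Finset.sum_ite_eq Finset.univ v, if_pos (Finset.mem_univ v),
        ← Set.ncard_coe_finset]
      simp only [Finset.coe_filter, Finset.mem_univ, true_and]
      rw [add_sub_cancel, div_self hr']
    · rw [← Finset.sum_div, Finset.sum_add_distrib, Finset.sum_boole,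
        Finset.sum_ite_eq' Finset.univ v, if_pos (Finset.mem_univ v),
        ← Set.ncard_coe_finset]
      simp only [Finset.coe_filter, Finset.mem_univ, true_and]
      rw [hin, add_sub_cancel, div_self hr']
  obtain ⟨w, hw0, hw1, hwM⟩ := exists_eq_sum_perm_of_mem_doublyStochastic hM
  obtain ⟨σ, hσ⟩ : ∃ σ, 0 < w σ := by
    by_contra! h
    have : ∑ σ, w σ ≤ 0 := Finset.sum_nonpos fun σ _ => h σ
    rw [hw1] at this
    norm_num at this
  refine ⟨σ, fun v => ?_⟩
  have hpos : 0 < M v (σ v) := by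
    rw [← hwM, Matrix.sum_apply]
    refine lt_of_lt_of_le hσ ?_
    refine le_trans (b := (w σ • σ.permMatrix ℚ) v (σ v)) (by simp [Equiv.toPEquiv_apply]) ?_
    refine Finset.single_le_sum (f := fun τ => (w τ • Equiv.Perm.permMatrix ℚ τ) v (σ v))
      (fun τ _ => ?_) (Finset.mem_univ σ)
    have : (0 : ℚ) ≤ Equiv.Perm.permMatrix ℚ τ v (σ v) := by
      rw [Equiv.Perm.permMatrix, PEquiv.toMatrix_apply]
      split_ifs <;> simp
    exact mul_nonneg (hw0 τ) this
  by_contra! hcon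
  obtain ⟨h1, h2⟩ := hcon
  simp only [M, h1, if_false, zero_add] at hpos
  split_ifs at hpos with h
  · have h3 : (r : ℚ) ≤ {w | A v w}.ncard := by exact_mod_cast h2 h.symm
    have h4 : (r - {w | A v w}.ncard : ℚ) / r ≤ 0 :=
      div_nonpos_of_nonpos_of_nonneg (by linarith) (by positivity)
    exact absurd hpos (not_lt.mpr h4)
  · simp at hpos

/-- The permutation follows arcs of a balanced orientation, so it has no cycles of length two. A
moved vertex loses two edges; a fixed one has out-degree at most `r`, hence degree at most `2r`
already. -/
theorem exists_splittable_of_even [Finite U] (H : SimpleGraph U) (r : ℕ)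
    (hdeg : ∀ v, (H.neighborSet v).ncard ≤ 2 * (r + 1))
    (heven : ∀ v, Even (H.neighborSet v).ncard) :
    ∃ C ≤ H, Splittable C ∧ ∀ v, ((H \ C).neighborSet v).ncard ≤ 2 * r := by
  classical
  have := Fintype.ofFinite U
  have hd : ∀ v, H.degree v = (H.neighborSet v).ncard := fun v => by
    rw [← SimpleGraph.card_neighborSet_eq_degree, ← Nat.card_eq_fintype_card]; rfl
  obtain ⟨A, hAH, hA, hout, hin⟩ := exists_balanced_orientation H (fun v => by
    rw [hd]; exact heven v)
  obtain ⟨σ, hσ⟩ := exists_perm_of_balanced A (r + 1) (by omega)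
    (fun v => by have := hout v; have := hdeg v; rw [← hd] at this; omega)
    (fun v => by have := hout v; have := hin v; omega)
  have hσA : ∀ v, σ v ≠ v → A v (σ v) := fun v hv => (hσ v).resolve_right fun h => hv h.1
  have h2 : ∀ v, σ v ≠ v → σ (σ v) ≠ v := by
    intro v hv h
    have h1 := hσA (σ v) (by rw [h]; exact hv.symm)
    rw [h] at h1
    exact hA _ _ (hσA v hv) h1
  have hC : permGraph σ ≤ H := by
    rintro v w ⟨hne, rfl | rfl⟩
    · exact hAH _ _ (hσA v hne.symm)
    · exact (hAH _ _ (hσA w hne)).symm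
  refine ⟨permGraph σ, hC, splittable_permGraph σ h2, fun v => ?_⟩
  have hsd : (H \ permGraph σ).neighborSet v = H.neighborSet v \ (permGraph σ).neighborSet v := rfl
  by_cases hv : σ v = v
  · have hlt : {w | A v w}.ncard < r + 1 := by
      rcases hσ v with h | h
      · rw [hv] at h; exact absurd rfl (hAH v v h).ne
      · exact h.2
    have h3 := hout v
    rw [hd] at h3
    have := Set.ncard_le_ncard (s := H.neighborSet v \ (permGraph σ).neighborSet v)
      (t := H.neighborSet v) Set.sdiff_subset (Set.toFinite _)
    rw [hsd]
    omega
  · have hv' : σ.symm v ≠ v := fun h => hv (by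
      have := congrArg σ h; rw [Equiv.apply_symm_apply] at this; exact this.symm)
    have hpair : ({σ v, σ.symm v} : Set U) ⊆ (permGraph σ).neighborSet v := by
      rintro w (rfl | rfl)
      · exact ⟨Ne.symm hv, Or.inl rfl⟩
      · exact ⟨hv'.symm, Or.inr (by simp)⟩
    have hcard : ({σ v, σ.symm v} : Set U).ncard = 2 := Set.ncard_pair (fun h => h2 v hv (by
      rw [h, Equiv.apply_symm_apply]))
    have h3 := Set.ncard_le_ncard hpair (Set.toFinite _)
    have h4 := Set.ncard_sdiff_add_ncard_of_subset (s := (permGraph σ).neighborSet v)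
      (t := H.neighborSet v) (fun w hw => hC hw) (Set.toFinite _)
    have := hdeg v
    rw [hsd]
    omega

/-- Every graph of maximum degree at most `2 (r + 1)` contains a splittable graph the removal of
which leaves maximum degree at most `2 r`. -/
theorem exists_splittable [Finite V] (G : SimpleGraph V) (r : ℕ)
    (hdeg : ∀ v, (G.neighborSet v).ncard ≤ 2 * (r + 1)) :
    ∃ C ≤ G, Splittable C ∧ ∀ v, ((G \ C).neighborSet v).ncard ≤ 2 * r := by
  classical
  -- Two copies of `G`, with the two copies of each odd vertex joined, have even degrees only; the
  -- even bound `2(r + 1)` remains valid.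
  let H : SimpleGraph (V × Bool) :=
    { Adj := fun p q => (p.2 = q.2 ∧ G.Adj p.1 q.1) ∨
        (p.2 ≠ q.2 ∧ p.1 = q.1 ∧ Odd (G.neighborSet p.1).ncard)
      symm := ⟨by
        rintro p q (⟨h1, h2⟩ | ⟨h1, h2, h3⟩)
        · exact Or.inl ⟨h1.symm, h2.symm⟩
        · exact Or.inr ⟨h1.symm, h2.symm, h2 ▸ h3⟩⟩
      loopless := ⟨by
        rintro p (⟨h1, h2⟩ | ⟨h1, h2, h3⟩)
        · exact h2.ne rfl
        · exact h1 rfl⟩ }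
  have hn : ∀ p : V × Bool, (H.neighborSet p).ncard = (G.neighborSet p.1).ncard +
      if Odd (G.neighborSet p.1).ncard then 1 else 0 := by
    rintro ⟨v, a⟩
    have h1 : H.neighborSet (v, a) = (fun w => (w, a)) '' G.neighborSet v ∪
        if Odd (G.neighborSet v).ncard then {(v, !a)} else ∅ := by
      ext ⟨w, b⟩
      rw [Set.mem_union]
      split_ifs with h
      · simp only [H, SimpleGraph.mem_neighborSet, h, Set.mem_image, Set.mem_singleton_iff,
          Prod.mk.injEq, and_true]
        refine or_congr ⟨fun ⟨h1, h2⟩ => ⟨w, h2, rfl, h1⟩, ?_⟩ ?_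
        · rintro ⟨u, h2, rfl, rfl⟩
          exact ⟨rfl, h2⟩
        · rw [eq_comm (a := v)]
          cases a <;> cases b <;> simp
      · simp only [H, SimpleGraph.mem_neighborSet, h, Set.mem_image, Prod.mk.injEq, and_false,
          or_false, Set.mem_empty_iff_false]
        exact ⟨fun ⟨h1, h2⟩ => ⟨w, h2, rfl, h1⟩, by
          rintro ⟨u, h2, rfl, rfl⟩
          exact ⟨rfl, h2⟩⟩
    rw [h1, Set.ncard_union_eq ?_ (Set.toFinite _) (Set.toFinite _),
      Set.ncard_image_of_injective _ (fun x y h => (Prod.mk.inj h).1)]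
    · split_ifs <;> simp
    · rw [Set.disjoint_left]
      rintro _ ⟨w, -, rfl⟩
      split_ifs
      · simp
      · simp
  obtain ⟨C, hC, hCs, hCd⟩ := exists_splittable_of_even H r (fun p => by
      rw [hn]
      have := hdeg p.1
      split_ifs with h
      · obtain ⟨k, hk⟩ := h; omega
      · omega) (fun p => by
      rw [hn]
      split_ifs with h
      · exact h.add_one
      · exact Nat.not_odd_iff_even.mp h)
  let f : V ↪ V × Bool := ⟨fun v => (v, false), fun x y h => (Prod.mk.inj h).1⟩
  refine ⟨C.comap f, fun v w hvw => ?_, hCs.comap f, fun v => ?_⟩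
  · rcases hC hvw with h | h
    · exact h.2
    · exact absurd rfl h.1
  · refine le_trans ?_ (hCd (f v))
    rw [← Set.ncard_image_of_injective _ f.injective]
    refine Set.ncard_le_ncard ?_ (Set.toFinite _)
    rintro _ ⟨w, ⟨h1, h2⟩, rfl⟩
    exact ⟨Or.inl ⟨rfl, h1⟩, h2⟩

end Petersen

/-! ### Distributing the odd vertices over the colours. -/

section ColourFamilies

variable {V : Type*}

theorem graphChainSum_eq_add [Finite V] {G F F' : SimpleGraph V} (h : G = F ⊔ F')
    (hd : ∀ v w, F.Adj v w → ¬ F'.Adj v w) :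
    graphChainSum G = graphChainSum F + graphChainSum F' := by
  classical
  rw [graphChainSum, graphChainSum, graphChainSum, ← Finsupp.mapDomain_add]
  congr 1
  ext e
  rw [Finsupp.add_apply, graphChain_apply, graphChain_apply, graphChain_apply, h]
  induction e with
  | _ v w =>
    have := hd v w
    by_cases h1 : F.Adj v w <;> by_cases h2 : F'.Adj v w <;> simp_all

theorem not_reachable_of_neighborSet_eq_empty {F : SimpleGraph V} {x y : V}
    (h : F.neighborSet x = ∅) (hxy : x ≠ y) : ¬ F.Reachable x y := by
  rintro ⟨w⟩
  cases w with
  | nil => exact hxy rfl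
  | cons hadj _ => exact h.subset hadj

/-- Four vertices can be distributed in pairs to the two linear forests of a splitting so that they
can serve as ends of paths, without lying in the same component. -/
theorem Splittable.exists_pairing [Finite V] {C : SimpleGraph V} (hC : Splittable C)
    {S : Finset V} (hS : S.card = 4) :
    ∃ (F F' : SimpleGraph V) (p q p' q' : V), IsLinearForest F ∧ IsLinearForest F' ∧
      (∀ v w, F.Adj v w → ¬ F'.Adj v w) ∧ C = F ⊔ F' ∧ [p, q, p', q'].Perm S.toList ∧
      (F.neighborSet p).Subsingleton ∧ (F.neighborSet q).Subsingleton ∧ ¬ F.Reachable p q ∧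
      (F'.neighborSet p').Subsingleton ∧ (F'.neighborSet q').Subsingleton ∧
      ¬ F'.Reachable p' q' := by
  classical
  obtain ⟨F, F', h1, h2, h3, h4, h5, h6⟩ := hC S hS.le
  have h1' : IsLinearForest F' := isLinearForest_of_subsingleton F' h2
  suffices H : ∃ p q p' q', [p, q, p', q'].Perm S.toList ∧
      (F.neighborSet p).Subsingleton ∧ (F.neighborSet q).Subsingleton ∧ ¬ F.Reachable p q ∧
      ¬ F'.Reachable p' q' by
    obtain ⟨p, q, p', q', g1, g2, g3, g4, g5⟩ := H
    exact ⟨F, F', p, q, p', q', h1, h1', h3, h4, g1, g2, g3, g4, h2 _, h2 _, g5⟩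
  by_cases hint : ∃ a ∈ S, ¬ (F.neighborSet a).Subsingleton
  -- Here `a` has degree two in `F` and is isolated in `F'`, so in `F'` it can be paired with any
  -- other vertex. The other three have degree at most one in `F` and do not all lie in one
  -- component, which provides a pair for `F`.
  · obtain ⟨a, ha, hai⟩ := hint
    have hothers : ∀ b ∈ S.erase a, (F.neighborSet b).Subsingleton := fun b hb => by
      by_contra hbi
      exact Finset.ne_of_mem_erase hb (h6 b (Finset.mem_of_mem_erase hb) a ha hbi hai)
    obtain ⟨b, c, d, hbc, hbd, hcd, he⟩ := Finset.card_eq_three.mp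
      (show (S.erase a).card = 3 by rw [Finset.card_erase_of_mem ha, hS])
    have hp : [a, b, c, d].Perm S.toList := by
      refine (List.perm_ext_iff_of_nodup ?_ (Finset.nodup_toList S)).mpr fun x => ?_
      · have : a ∉ S.erase a := Finset.notMem_erase a S
        rw [he] at this
        simp only [Finset.mem_insert, Finset.mem_singleton, not_or] at this
        simp [this, hbc, hbd, hcd]
      · rw [Finset.mem_toList, ← Finset.insert_erase ha, he]
        simp
    have hb := hothers b (by rw [he]; simp)
    have hc := hothers c (by rw [he]; simp)
    have hd := hothers d (by rw [he]; simp)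
    have hn := hp.nodup_iff.mpr (Finset.nodup_toList S)
    simp only [List.nodup_cons, List.mem_cons, List.not_mem_nil, or_false, not_or] at hn
    by_cases hr : F.Reachable b c
    · refine ⟨b, d, a, c, ?_, hb, hd, fun hr' => h1.not_reachable hb hc hd hbc hbd hcd ⟨hr, hr'⟩,
        not_reachable_of_neighborSet_eq_empty (h5 a hai) hn.1.2.1⟩
      refine List.Perm.trans ?_ hp
      exact (List.perm_append_comm (l₁ := [b, d]) (l₂ := [a, c])).trans
        (((List.perm_append_comm (l₁ := [c]) (l₂ := [b, d])).trans
          ((List.Perm.swap c d []).cons b)).cons a)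
    · refine ⟨b, c, a, d, ?_, hb, hc, hr,
        not_reachable_of_neighborSet_eq_empty (h5 a hai) hn.1.2.2⟩
      exact (List.perm_middle (l₁ := [b, c]) (l₂ := [d])).trans hp
  · push Not at hint
    obtain ⟨a, b, c, d, hl⟩ : ∃ a b c d, S.toList = [a, b, c, d] := by
      have : S.toList.length = 4 := by rw [Finset.length_toList, hS]
      rcases h : S.toList with _ | ⟨a, _ | ⟨b, _ | ⟨c, _ | ⟨d, _ | ⟨e, l⟩⟩⟩⟩⟩ <;>
        simp_all
    have hm : ∀ x ∈ [a, b, c, d], (F.neighborSet x).Subsingleton := fun x hx =>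
      hint x (by rwa [← hl, Finset.mem_toList] at hx)
    have ha := hm a (by simp)
    have hb := hm b (by simp)
    have hc := hm c (by simp)
    have hd := hm d (by simp)
    have hn := hl ▸ Finset.nodup_toList S
    simp only [List.nodup_cons, List.mem_cons, List.not_mem_nil, or_false, not_or] at hn
    obtain ⟨⟨hab, hac, had⟩, ⟨hbc, hbd⟩, hcd, -⟩ := hn
    -- Of the three pairings, with the pair of `a` assigned to `F`, at most one fails because of
    -- `F`, where the component of `a` contains at most one of `b`, `c`, `d`. At most one fails
    -- because of `F'`, where at most two of `b`, `c`, `d` share a component.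
    by_contra! hcon
    rw [hl] at hcon
    have c1 := hcon a b c d (List.Perm.refl _) ha hb
    have c2 := hcon a c b d ((List.Perm.swap b c [d]).cons a) ha hc
    have c3 := hcon a d b c ((List.perm_append_comm (l₁ := [d]) (l₂ := [b, c])).cons a) ha hd
    have r1 := h1.not_reachable ha hb hc hab hac hbc
    have r2 := h1.not_reachable ha hb hd hab had hbd
    have r3 := h1.not_reachable ha hc hd hac had hcd
    have s1 := h1'.not_reachable (h2 d) (h2 c) (h2 b) (Ne.symm hcd) (Ne.symm hbd) (Ne.symm hbc)
    have s2 := h1'.not_reachable (h2 c) (h2 d) (h2 b) hcd (Ne.symm hbc) (Ne.symm hbd)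
    have s3 := h1'.not_reachable (h2 b) (h2 d) (h2 c) hbd hbc (Ne.symm hcd)
    rw [SimpleGraph.reachable_comm (u := d) (v := c),
      SimpleGraph.reachable_comm (u := d) (v := b)] at s1
    rw [SimpleGraph.reachable_comm (u := c) (v := b)] at s2
    tauto

/-- A splittable graph yields two colours with dummy edges for two or four given vertices. -/
theorem Splittable.exists_colours [Finite V] {C : SimpleGraph V} (hC : Splittable C)
    {S : Finset V} (hS : S.card = 4 ∨ S.card = 2) :
    ∃ (L : Bool → List (List (V ⊕ ℕ))) (x y : Bool → V ⊕ ℕ), (∀ b, IsPathSystem (L b)) ∧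
      (∀ b, s(x b, y b) ∈ sysEdges (L b)) ∧
      ∑ b, sysChain (L b) = graphChainSum C + ∑ b, edgeChain (x b) (y b) ∧
      bdry (∑ b, edgeChain (x b) (y b)) = ∑ v ∈ S, Finsupp.single (Sum.inl v) 1 := by
  classical
  have hsum : ∀ l : List V, l.Perm S.toList →
      (∑ v ∈ S, Finsupp.single (Sum.inl v) 1 : V ⊕ ℕ →₀ ZMod 2) =
        (l.map fun v => Finsupp.single (Sum.inl v) 1).sum := fun l hl => by
    rw [(hl.map _).sum_eq, Finset.sum_map_toList]
  rcases hS with hS | hS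
  · obtain ⟨F, F', p, q, p', q', h1, h2, h3, h4, h5, h6, h7, h8, h9, h10, h11⟩ :=
      hC.exists_pairing hS
    obtain ⟨L, l1, l2, l3⟩ := h1.exists_pathSystem_edge h6 h7 h8
    obtain ⟨L', m1, m2, m3⟩ := h2.exists_pathSystem_edge h9 h10 h11
    refine ⟨fun b => if b then L else L', fun b => Sum.inl (if b then p else p'),
      fun b => Sum.inl (if b then q else q'), ?_, ?_, ?_, ?_⟩
    · rintro (_ | _) <;> assumption
    · rintro (_ | _) <;> assumption
    · rw [graphChainSum_eq_add h4 h3, Fintype.sum_bool, Fintype.sum_bool]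
      simp only [if_true, Bool.false_eq_true, if_false]
      rw [l2, m2]
      abel
    · rw [hsum _ h5, Fintype.sum_bool, map_add, bdry_edgeChain, bdry_edgeChain]
      simp [add_assoc]
  -- Both dummy edges end in the same new vertex `Sum.inr 0`, where their boundaries cancel.
  · obtain ⟨F, F', h1, h2, h3, h4, h5, h6⟩ := hC S (by omega)
    have h1' : IsLinearForest F' := isLinearForest_of_subsingleton F' h2
    obtain ⟨a, b, hl, ha⟩ : ∃ a b, [a, b].Perm S.toList ∧ (F.neighborSet a).Subsingleton := by
      obtain ⟨a, b, hl⟩ : ∃ a b, S.toList = [a, b] := by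
        have : S.toList.length = 2 := by rw [Finset.length_toList, hS]
        rcases h : S.toList with _ | ⟨a, _ | ⟨b, _ | ⟨c, l⟩⟩⟩ <;> simp_all
      have hab : a ≠ b := by
        have := hl ▸ Finset.nodup_toList S
        simpa using this
      have haS : a ∈ S := by rw [← Finset.mem_toList, hl]; simp
      have hbS : b ∈ S := by rw [← Finset.mem_toList, hl]; simp
      rw [hl]
      by_cases ha : (F.neighborSet a).Subsingleton
      · exact ⟨a, b, List.Perm.refl _, ha⟩
      · exact ⟨b, a, List.Perm.swap _ _ _, by
          by_contra hb
          exact hab (h6 a haS b hbS ha hb)⟩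
    obtain ⟨L, l1, l2, l3⟩ := h1.exists_pathSystem_new ha
    obtain ⟨L', m1, m2, m3⟩ := h1'.exists_pathSystem_new (h2 b)
    refine ⟨fun i => if i then L else L', fun i => Sum.inl (if i then a else b),
      fun _ => Sum.inr 0, ?_, ?_, ?_, ?_⟩
    · rintro (_ | _) <;> assumption
    · rintro (_ | _) <;> assumption
    · rw [graphChainSum_eq_add h4 h3, Fintype.sum_bool, Fintype.sum_bool]
      simp only [if_true, Bool.false_eq_true, if_false]
      rw [l2, m2]
      abel
    · rw [hsum _ hl, Fintype.sum_bool, map_add, bdry_edgeChain, bdry_edgeChain,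
        add_add_add_comm, ZModModule.add_self]
      simp

/-- Two colours can be split off for every four, or for every two, vertices of odd degree. -/
theorem exists_colour_family [Finite V] (t r : ℕ) (G : SimpleGraph V)
    (hdeg : ∀ v, (G.neighborSet v).ncard ≤ 2 * (r + t)) (O : Finset V) (hO : Even O.card)
    (h2 : 2 * t ≤ O.card) (h4 : O.card ≤ 4 * t) :
    ∃ (R : SimpleGraph V) (ι : Type) (_ : Fintype ι) (L : ι → List (List (V ⊕ ℕ)))
      (x y : ι → V ⊕ ℕ), (∀ v, (R.neighborSet v).ncard ≤ 2 * r) ∧ Fintype.card ι = 2 * t ∧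
      (∀ i, IsPathSystem (L i)) ∧ (∀ i, s(x i, y i) ∈ sysEdges (L i)) ∧
      ∑ i, sysChain (L i) + graphChainSum R = graphChainSum G + ∑ i, edgeChain (x i) (y i) ∧
      bdry (∑ i, edgeChain (x i) (y i)) = ∑ v ∈ O, Finsupp.single (Sum.inl v) 1 := by
  classical
  induction t generalizing G O with
  | zero =>
    have : O = ∅ := Finset.card_eq_zero.mp (by omega)
    subst this
    exact ⟨G, Empty, inferInstance, Empty.elim, Empty.elim, Empty.elim, hdeg, by simp,
      fun i => i.elim, fun i => i.elim, by simp, by simp⟩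
  | succ t ih =>
    obtain ⟨C, hC, hCs, hCd⟩ := exists_splittable G (r + t) hdeg
    obtain ⟨S, hSO, hS, g1, g2⟩ : ∃ S ⊆ O, (S.card = 4 ∨ S.card = 2) ∧
        2 * t + S.card ≤ O.card ∧ O.card ≤ 4 * t + S.card := by
      obtain ⟨k, hk⟩ := hO
      -- Four vertices are taken if two remain for each of the other `t` rounds. Otherwise, by
      -- parity, `O` has exactly `2t + 2` elements and two are taken.
      by_cases h : 2 * t + 4 ≤ O.card
      · obtain ⟨S, hS, hc⟩ := Finset.exists_subset_card_eq (show 4 ≤ O.card by omega)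
        exact ⟨S, hS, Or.inl hc, by omega, by omega⟩
      · obtain ⟨S, hS, hc⟩ := Finset.exists_subset_card_eq (show 2 ≤ O.card by omega)
        exact ⟨S, hS, Or.inr hc, by omega, by omega⟩
    have hcard := Finset.card_sdiff_add_card_eq_card hSO
    obtain ⟨R, ι, _, L, x, y, f1, f2, f3, f4, f5, f6⟩ := ih (G \ C) hCd (O \ S)
      (by
        obtain ⟨k, hk⟩ := hO
        rcases hS with hS | hS
        · exact ⟨k - 2, by omega⟩
        · exact ⟨k - 1, by omega⟩) (by omega) (by omega)
    obtain ⟨L', x', y', e1, e2, e3, e4⟩ := hCs.exists_colours hS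
    refine ⟨R, ι ⊕ Bool, inferInstance, Sum.elim L L', Sum.elim x x', Sum.elim y y', f1, ?_,
      ?_, ?_, ?_, ?_⟩
    · rw [Fintype.card_sum, f2, Fintype.card_bool]; ring
    · rintro (i | i)
      · exact f3 i
      · exact e1 i
    · rintro (i | i)
      · exact f4 i
      · exact e2 i
    · have hG : graphChainSum G = graphChainSum C + graphChainSum (G \ C) :=
        graphChainSum_eq_add (by rw [sup_sdiff_cancel_right hC]) fun v w h h' => h'.2 h
      rw [Fintype.sum_sum_type, Fintype.sum_sum_type]
      simp only [Sum.elim_inl, Sum.elim_inr]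
      rw [hG, e3, add_right_comm, f5]
      abel
    · rw [Fintype.sum_sum_type]
      simp only [Sum.elim_inl, Sum.elim_inr]
      rw [map_add, f6, e4, Finset.sum_sdiff hSO]

/-- The number of colours bounds `p_{2,iso}`. -/
theorem pathOddCoverNumberIso_le_card [Finite V] (G : SimpleGraph V) {ι : Type*} [Fintype ι]
    (K : Finset ι) (hK : (Fintype.card ι : ℤ) - K.card ≠ 1) (L : ι → List (List (V ⊕ ℕ)))
    (x y : ι → V ⊕ ℕ) (hL : ∀ i, IsPathSystem (L i)) (he : ∀ i ∈ K, s(x i, y i) ∈ sysEdges (L i))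
    (hc : ∑ i, sysChain (L i) = graphChainSum G + ∑ i ∈ K, edgeChain (x i) (y i))
    (hb : bdry (∑ i ∈ K, edgeChain (x i) (y i)) = bdry (graphChainSum G)) :
    pathOddCoverNumberIso G ≤ Fintype.card ι := by
  obtain ⟨P, h1, h2⟩ := exists_paths x y Finset.univ K (Finset.subset_univ K)
    (by rwa [Finset.card_univ]) L hL he (by rw [hc, map_add, hb, ZModModule.add_self])
  refine pathOddCoverNumberIso_le G P h1 ?_
  rw [h2, hc, add_assoc, ZModModule.add_self, add_zero]

end ColourFamilies

/-! ### Decomposing the remainder by linear arboricity. -/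

section LinearArboricity

theorem not_isAcyclic_of_triangle {V : Type*} {F : SimpleGraph V} {a b c : V} (hab : F.Adj a b)
    (hbc : F.Adj b c) (hac : F.Adj a c) : ¬ F.IsAcyclic := by
  intro h
  have := SimpleGraph.isAcyclic_iff_forall_adj_isBridge.mp h hab
  rw [SimpleGraph.isBridge_iff] at this
  refine this (SimpleGraph.Adj.reachable (v := c) ?_ |>.trans
    (SimpleGraph.Adj.reachable (u := c) ?_))
  · rw [SimpleGraph.deleteEdges_adj]
    refine ⟨hac, fun h => ?_⟩
    rcases Sym2.eq_iff.mp h with ⟨-, rfl⟩ | ⟨rfl, -⟩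
    · exact hbc.ne rfl
    · exact hab.ne rfl
  · rw [SimpleGraph.deleteEdges_adj]
    refine ⟨hbc.symm, fun h => ?_⟩
    rcases Sym2.eq_iff.mp h with ⟨rfl, -⟩ | ⟨rfl, -⟩
    · exact hac.ne rfl
    · exact hbc.ne rfl

/-- A graph of maximum degree at most the even number `d` decomposes into at most `la(d)`, but not
exactly one, linear forests. -/
theorem exists_linearForests {V : Type*} [Finite V] (R : SimpleGraph V) {d : ℕ} (hd : Even d)
    (hR : ∀ v, (R.neighborSet v).ncard ≤ d) :
    ∃ (k : ℕ) (F : Fin k → SimpleGraph V), k ≤ maxLinearArboricity d ∧ k ≠ 1 ∧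
      (∀ i, IsLinearForest (F i)) ∧ ∑ i, graphChainSum (F i) = graphChainSum R := by
  classical
  have := Fintype.ofFinite V
  -- A disjoint complete graph on `d + 1` vertices makes the maximum degree exactly `d`, as the
  -- definition of `la(d)` requires, and prevents a decomposition into one forest.
  let W := V ⊕ Fin (d + 1)
  let φ : W ≃ Fin (Fintype.card W) := Fintype.equivFin W
  let H : SimpleGraph (Fin (Fintype.card W)) :=
    (R ⊕g (⊤ : SimpleGraph (Fin (d + 1)))).comap φ.symm
  have hnb : ∀ w, H.neighborSet w =
      φ '' ((R ⊕g (⊤ : SimpleGraph (Fin (d + 1)))).neighborSet (φ.symm w)) := by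
    intro w
    ext u
    simp [H, Equiv.image_eq_preimage_symm]
  have hinl : ∀ v, (R ⊕g (⊤ : SimpleGraph (Fin (d + 1)))).neighborSet (Sum.inl v) =
      Sum.inl '' R.neighborSet v := by
    intro v
    ext (u | u) <;> simp
  have hinr : ∀ v, (R ⊕g (⊤ : SimpleGraph (Fin (d + 1)))).neighborSet (Sum.inr v) =
      Sum.inr '' {v}ᶜ := by
    intro v
    ext (u | u) <;> simp [eq_comm]
  have hdeg : ∀ w, H.degree w = (H.neighborSet w).ncard := fun w => by
    rw [← SimpleGraph.card_neighborSet_eq_degree, ← Nat.card_eq_fintype_card]; rfl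
  have hdegr : ∀ v, H.degree (φ (Sum.inr v)) = d := by
    intro v
    rw [hdeg, hnb, Set.ncard_image_of_injective _ φ.injective, Equiv.symm_apply_apply, hinr,
      Set.ncard_image_of_injective _ Sum.inr_injective, Set.ncard_compl]
    simp
  have hmax : H.maxDegree = d := by
    refine le_antisymm (SimpleGraph.maxDegree_le_of_forall_degree_le _ _ fun w => ?_) ?_
    · obtain ⟨v | v, rfl⟩ := φ.surjective w
      · rw [hdeg, hnb, Set.ncard_image_of_injective _ φ.injective, Equiv.symm_apply_apply, hinl,
          Set.ncard_image_of_injective _ Sum.inl_injective]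
        exact hR v
      · exact (hdegr v).le
    · exact (hdegr 0).ge.trans (H.degree_le_maxDegree _)
  obtain ⟨F, hF1, hF2, hF3⟩ := linearArboricity_spec H
  let f : V ↪ Fin (Fintype.card W) := ⟨fun v => φ (Sum.inl v), φ.injective.comp Sum.inl_injective⟩
  have hedge : ∀ u v, R.Adj u v ↔ ∃ i, (F i).Adj (f u) (f v) := by
    intro u v
    have h1 : s(f u, f v) ∈ (⋃ i, (F i).edgeSet) ↔ s(f u, f v) ∈ H.edgeSet := by rw [hF3]
    rw [Set.mem_iUnion] at h1
    simp only [SimpleGraph.mem_edgeSet] at h1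
    rw [h1]
    simp [H, f]
  refine ⟨linearArboricity H, fun i => (F i).comap f,
    (maxLinearArboricity_isGreatest d).2 ⟨_, H, inferInstance, hmax, rfl⟩, fun h1 => ?_,
    fun i => (hF1 i).comap f, ?_⟩
  -- For `d = 0` there are no edges and the linear arboricity is zero. A positive even `d` is at
  -- least two, so the complete graph contains a triangle.
  · rcases Nat.eq_zero_or_pos d with rfl | hpos
    · have h0 : linearArboricity H ≤ 0 := by
        refine Nat.sInf_le ⟨fun i => i.elim0, fun i => i.elim0, fun i => i.elim0, ?_⟩
        rw [Set.iUnion_of_empty, eq_comm, SimpleGraph.edgeSet_eq_empty]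
        ext u v
        simp only [SimpleGraph.bot_adj, iff_false]
        intro huv
        have h2 := H.degree_le_maxDegree u
        rw [hmax, Nat.le_zero, SimpleGraph.degree_eq_zero_iff_notMem_support] at h2
        exact h2 ⟨v, huv⟩
      omega
    · obtain ⟨k, hk⟩ := hd
      have hsub : ∀ i j : Fin (linearArboricity H), i = j := fun i j => Fin.ext (by omega)
      have hadj : ∀ a b : Fin (d + 1), a ≠ b →
          (F ⟨0, by omega⟩).Adj (φ (Sum.inr a)) (φ (Sum.inr b)) := by
        intro a b hab
        have h2 : s(φ (Sum.inr a), φ (Sum.inr b)) ∈ ⋃ i, (F i).edgeSet := by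
          rw [hF3]
          simp [H, hab]
        obtain ⟨i, hi⟩ := Set.mem_iUnion.mp h2
        rw [hsub ⟨0, by omega⟩ i]
        exact hi
      exact not_isAcyclic_of_triangle
        (hadj ⟨0, by omega⟩ ⟨1, by omega⟩ (by simp))
        (hadj ⟨1, by omega⟩ ⟨2, by omega⟩ (by simp))
        (hadj ⟨0, by omega⟩ ⟨2, by omega⟩ (by simp)) (hF1 _).1
  · simp only [graphChainSum]
    rw [← Finsupp.mapDomain_finsetSum]
    congr 1
    ext e
    rw [Finsupp.finsetSum_apply, graphChain_apply]
    induction e with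
    | _ u v =>
      simp only [graphChain_apply, SimpleGraph.mem_edgeSet, SimpleGraph.comap_adj]
      split_ifs with h
      · obtain ⟨i, hi⟩ := (hedge u v).mp h
        rw [Finset.sum_eq_single_of_mem i (Finset.mem_univ i), if_pos hi]
        intro j _ hji
        rw [if_neg]
        intro hj
        exact Set.disjoint_left.mp (hF2 j i hji) (show s(f u, f v) ∈ (F j).edgeSet from hj) hi
      · refine Finset.sum_eq_zero fun i _ => if_neg fun hi => h ((hedge u v).mpr ⟨i, hi⟩)

end LinearArboricity

/-! ### The three bounds behind the theorem. -/

section Main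

variable {V : Type*} [Fintype V] (G : SimpleGraph V) [DecidableRel G.Adj]

theorem ncard_neighborSet_le_maxDegree (v : V) : (G.neighborSet v).ncard ≤ G.maxDegree := by
  refine le_trans (le_of_eq ?_) (G.degree_le_maxDegree v)
  rw [← SimpleGraph.card_neighborSet_eq_degree, ← Nat.card_eq_fintype_card]
  rfl

theorem even_oddDegreeCount : Even (oddDegreeCount G) :=
  G.even_card_odd_degree_vertices

/-- The peeled graphs give `2t` colours with dummy edges. The colours without are those of the
remainder, and their number is not one. -/
theorem pathOddCoverNumberIso_le_add (t r : ℕ) (hdeg : G.maxDegree ≤ 2 * (r + t))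
    (h2 : 2 * t ≤ oddDegreeCount G) (h4 : oddDegreeCount G ≤ 4 * t) :
    pathOddCoverNumberIso G ≤ 2 * t + maxLinearArboricity (2 * r) := by
  classical
  obtain ⟨R, ι, _, L, x, y, f1, f2, f3, f4, f5, f6⟩ := exists_colour_family t r G
    (fun v => (ncard_neighborSet_le_maxDegree G v).trans hdeg) _ (even_oddDegreeCount G) h2 h4
  obtain ⟨k, F, hk, hk1, hF, hFs⟩ := exists_linearForests R (even_two_mul r) f1
  choose L' e1 e2 using fun i => (hF i).exists_pathSystem
  have hKs : ∀ g : ι ⊕ Fin k → (Sym2 (V ⊕ ℕ) →₀ ZMod 2),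
      ∑ i ∈ Finset.univ.map Function.Embedding.inl, g i = ∑ i : ι, g (Sum.inl i) :=
    fun g => Finset.sum_map _ _ _
  have := pathOddCoverNumberIso_le_card G (ι := ι ⊕ Fin k)
    (Finset.univ.map Function.Embedding.inl)
    (by
      rw [Finset.card_map, Finset.card_univ, Fintype.card_sum, Fintype.card_fin]
      push_cast
      omega)
    (Sum.elim L L') (Sum.elim x fun _ => Sum.inr 0) (Sum.elim y fun _ => Sum.inr 0)
    (by
      rintro (i | i)
      · exact f3 i
      · exact e1 i)
    (by
      intro i hi
      obtain ⟨j, -, rfl⟩ := Finset.mem_map.mp hi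
      exact f4 j)
    (by
      rw [Fintype.sum_sum_type, hKs]
      simp only [Sum.elim_inl, Sum.elim_inr]
      rw [Finset.sum_congr rfl fun i _ => e2 i, hFs, f5])
    (by
      rw [hKs]
      simp only [Sum.elim_inl]
      rw [f6, bdry_graphChainSum])
  rw [Fintype.card_sum, f2, Fintype.card_fin] at this
  omega

theorem eq_bot_of_ncard_neighborSet_le_zero {R : SimpleGraph V}
    (h : ∀ v, (R.neighborSet v).ncard ≤ 2 * 0) : R = ⊥ := by
  ext u v
  simp only [SimpleGraph.bot_adj, iff_false]
  intro huv
  have := (Set.ncard_eq_zero (Set.toFinite _)).mp (Nat.le_zero.mp (h u))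
  exact this.subset huv

/-- The remainder is empty, so every colour carries a dummy edge and the obstruction to closing
cannot arise. -/
theorem pathOddCoverNumberIso_le_of_eq_four_mul (t : ℕ) (hdeg : G.maxDegree ≤ 2 * t)
    (h4 : oddDegreeCount G = 4 * t) : pathOddCoverNumberIso G ≤ 2 * t := by
  obtain ⟨R, ι, _, L, x, y, f1, f2, f3, f4, f5, f6⟩ := exists_colour_family t 0 G
    (fun v => (ncard_neighborSet_le_maxDegree G v).trans (by omega)) _ (even_oddDegreeCount G)
    (by change 2 * t ≤ oddDegreeCount G; omega) h4.le
  obtain rfl := eq_bot_of_ncard_neighborSet_le_zero f1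
  rw [graphChainSum, graphChain_bot, Finsupp.mapDomain_zero, add_zero] at f5
  rw [← f2]
  exact pathOddCoverNumberIso_le_card G Finset.univ (by rw [Finset.card_univ]; omega) L x y f3
    (fun i _ => f4 i) f5 (by rw [f6, bdry_graphChainSum])

/-- Two odd vertices `a` and `b` are set aside for an extra colour consisting of the dummy edge `ab`
alone. It corrects the parity at `a` and `b`, and every colour still has a dummy edge. -/
theorem pathOddCoverNumberIso_le_of_eq_four_mul_add_two (t : ℕ) (hdeg : G.maxDegree ≤ 2 * t)
    (h4 : oddDegreeCount G = 4 * t + 2) : pathOddCoverNumberIso G ≤ 2 * t + 1 := by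
  classical
  have h4' : (Finset.univ.filter fun v : V => Odd (G.degree v)).card = 4 * t + 2 := h4
  set O := Finset.univ.filter fun v : V => Odd (G.degree v) with hO
  obtain ⟨S, hS, hSc⟩ := Finset.exists_subset_card_eq (show 2 ≤ O.card by omega)
  obtain ⟨a, b, hab, hSab⟩ := Finset.card_eq_two.mp hSc
  have hcard := Finset.card_sdiff_add_card_eq_card hS
  obtain ⟨R, ι, _, L, x, y, f1, f2, f3, f4, f5, f6⟩ := exists_colour_family t 0 G
    (fun v => (ncard_neighborSet_le_maxDegree G v).trans (by omega)) (O \ S)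
    ⟨2 * t, by omega⟩ (by omega) (by omega)
  obtain rfl := eq_bot_of_ncard_neighborSet_le_zero f1
  rw [graphChainSum, graphChain_bot, Finsupp.mapDomain_zero, add_zero] at f5
  have := pathOddCoverNumberIso_le_card G (ι := ι ⊕ Unit) Finset.univ
    (by rw [Finset.card_univ]; omega)
    (Sum.elim L fun _ => [[Sum.inl a, Sum.inl b]]) (Sum.elim x fun _ => Sum.inl a)
    (Sum.elim y fun _ => Sum.inl b)
    (by
      rintro (i | i)
      · exact f3 i
      · exact ⟨by simp [hab], by simp⟩)
    (by
      rintro (i | i) -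
      · exact f4 i
      · simp)
    (by
      rw [Fintype.sum_sum_type, Fintype.sum_sum_type]
      simp only [Sum.elim_inl, Sum.elim_inr]
      rw [f5]
      simp [add_assoc])
    (by
      rw [Fintype.sum_sum_type]
      simp only [Sum.elim_inl, Sum.elim_inr]
      rw [map_add, f6, bdry_graphChainSum, ← hO, ← Finset.sum_sdiff hS, hSab,
        Finset.sum_pair hab]
      simp)
  rw [Fintype.card_sum, f2, Fintype.card_unit] at this
  exact this

end Main

end PathOddCover

/-! ### The theorem: arithmetic of `t` and `d`. -/

theorem mainTheorem6 {V : Type*} [Fintype V] (G : SimpleGraph V) [DecidableRel G.Adj]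
    (t : ℕ) (ht : t = if PathOddCover.oddDegreeCount G = 4 ∧ 3 ≤ G.maxDegree then 2
      else ⌈(PathOddCover.oddDegreeCount G : ℚ) / 4⌉₊)
    (d : ℤ) (hd : d = 2 * ⌈(G.maxDegree : ℚ) / 2⌉ - 2 * (t : ℤ)) :
    (0 ≤ d → PathOddCover.pathOddCoverNumberIso G ≤
      2 * t + PathOddCover.maxLinearArboricity d.toNat) ∧
    (d < 0 → (PathOddCover.pathOddCoverNumberIso G : ℚ) ≤
      (PathOddCover.oddDegreeCount G : ℚ) / 2) := by
  obtain ⟨s, hs, hs1, hs2⟩ : ∃ s : ℕ, ⌈(G.maxDegree : ℚ) / 2⌉ = (s : ℤ) ∧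
      G.maxDegree ≤ 2 * s ∧ 2 * s ≤ G.maxDegree + 1 := by
    obtain ⟨s, h1, h2⟩ : ∃ s : ℕ, G.maxDegree ≤ 2 * s ∧ 2 * s ≤ G.maxDegree + 1 :=
      ⟨(G.maxDegree + 1) / 2, by omega, by omega⟩
    refine ⟨s, ?_, h1, h2⟩
    have h1' : (G.maxDegree : ℚ) ≤ 2 * s := by exact_mod_cast h1
    have h2' : (2 * s : ℚ) ≤ G.maxDegree + 1 := by exact_mod_cast h2
    rw [Int.ceil_eq_iff, Int.cast_natCast]
    constructor <;> linarith
  rw [hs] at hd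
  obtain ⟨m, hm⟩ := PathOddCover.even_oddDegreeCount G
  have hceil : PathOddCover.oddDegreeCount G ≤ 4 * ⌈(PathOddCover.oddDegreeCount G : ℚ) / 4⌉₊ ∧
      4 * ⌈(PathOddCover.oddDegreeCount G : ℚ) / 4⌉₊ < PathOddCover.oddDegreeCount G + 4 := by
    have h1 := Nat.le_ceil ((PathOddCover.oddDegreeCount G : ℚ) / 4)
    have h2 := Nat.ceil_lt_add_one
      (show (0 : ℚ) ≤ (PathOddCover.oddDegreeCount G : ℚ) / 4 by positivity)
    constructor
    · have : (PathOddCover.oddDegreeCount G : ℚ) ≤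
          4 * (⌈(PathOddCover.oddDegreeCount G : ℚ) / 4⌉₊ : ℚ) := by linarith
      exact_mod_cast this
    · have : 4 * (⌈(PathOddCover.oddDegreeCount G : ℚ) / 4⌉₊ : ℚ) <
          PathOddCover.oddDegreeCount G + 4 := by linarith
      exact_mod_cast this
  refine ⟨fun h0 => ?_, fun h0 => ?_⟩
  -- Both values of `t` satisfy `2t ≤ v_odd(G) ≤ 4t`, which is all that is needed.
  · obtain ⟨r, hr⟩ : ∃ r, s = r + t := ⟨s - t, by omega⟩
    have hdr : d.toNat = 2 * r := by omega
    rw [hdr]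
    refine PathOddCover.pathOddCoverNumberIso_le_add G t r (by omega) ?_ ?_ <;>
      split_ifs at ht <;> omega
  -- In the exceptional case `t = 2` and `Δ(G) ≥ 3`, so `d ≥ 0`.
  · rw [if_neg (by
      intro h
      rw [if_pos h] at ht
      omega)] at ht
    rw [← ht] at hceil
    rcases (show PathOddCover.oddDegreeCount G = 4 * t ∨
        PathOddCover.oddDegreeCount G = 4 * (t - 1) + 2 by omega) with h | h
    · have := PathOddCover.pathOddCoverNumberIso_le_of_eq_four_mul G t (by omega) h
      rw [h, le_div_iff₀ (by norm_num)]
      exact_mod_cast (show _ * 2 ≤ 4 * t by omega)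
    -- Since `d < 0` means `⌈Δ(G)/2⌉ ≤ t - 1`, already `t - 1` peeled graphs exhaust `G`.
    · have := PathOddCover.pathOddCoverNumberIso_le_of_eq_four_mul_add_two G (t - 1) (by omega) h
      rw [h, le_div_iff₀ (by norm_num)]
      exact_mod_cast (show _ * 2 ≤ 4 * (t - 1) + 2 by omega)
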